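/- Let $S^1=\mathbb R/\mathbb Z$, let $\mathrm{Diff}^\infty_+(S^1)$ be the group of orientation-preserving $C^\infty$ diffeomorphisms of $S^1$, and let $\rho(f)\in\mathbb R/\mathbb Z$ be the rotation number of $f$, i.e. the class modulo $\mathbb Z$ of $\lim_{n\to\infty}(\tilde f^n(x)-x)/n$ for a lift $\tilde f:\mathbb R\to\mathbb R$ of $f$. For $0\le r\le\infty$ the $C^r$-topology is that of uniform convergence of the maps and of all derivatives of finite order at most $r$. $\mathrm{PSL}(2,\mathbb R)$ acts on the real projective line, identified with $S^1$ by $x\mapsto[\cos\pi x:\sin\pi x]$; a Fuchsian group is a discrete subgroup of $\mathrm{PSL}(2,\mathbb R)$, viewed as a group of diffeomorphisms of $S^1$. An exceptional minimal set of a group $\Gamma$ of circle homeomorphisms is a nonempty closed $\Gamma$-invariant set $C\subset S^1$ which is homeomorphic to the Cantor set and in which the orbit of every point of $C$ is dense. Consider the following data: a finitely generated torsion-free Fuchsian group $\Gamma_1$ which has an exceptional minimal set $C$; a connected component $I$ of $S^1\setminus C$; a $C^\infty$ vector field $X\not\equiv 0$ on $S^1$ which vanishes outside $I$, with flow $(\varphi^t)_{t\in\mathbb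 R}$; and a subgroup $\Gamma_2$ of $\{\varphi^t: t\in\mathbb R\}$ which is isomorphic to $\mathbb Z\oplus\mathbb Z$ and dense in the flow, i.e. $\{t\in\mathbb R:\varphi^t\in\Gamma_2\}$ is dense in $\mathbb R$. Then: (1) Such data exist. (2) For all such data, the subgroup $\Gamma$ of $\mathrm{Diff}^\infty_+(S^1)$ generated by $\Gamma_1$ and $\Gamma_2$ is finitely generated, is not discrete with respect to the $C^\infty$-topology, contains a subgroup isomorphic to $\mathbb Z\oplus\mathbb Z$, satisfies $\rho(\Gamma)=\{0\}$, and has no finite orbit in $S^1$. (3) Consequently each of the following three assertions, which are known for subgroups of the group of orientation-preserving real analytic diffeomorphisms of $S^1$, is false for subgroups of $\mathrm{Diff}^\infty_+(S^1)$: (a) for every subgroup $\Gamma$ which is nondiscrete with respect to the $C^1$-topology, $\rho(\Gamma)$ is finite if and only if $\Gamma$ has a finite orbit; (b) every subgroup $\Gamma$ without finite orbit and with $\rho(\Gamma)$ finite is discrete with respect to the $C^1$-topology; (c) for every subgroup $\Gamma$ without finite orbit and with $\rho(\Gamma)$ finite, every subgroup $\Gamma'$ of $\Gamma$ is finite, or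 contains an infinite cyclic subgroup of finite index, or contains a nonabelian free subgroup. -/

import Mathlib

open scoped ContDiff

namespace CircleDiff

/-- The circle `ℝ/ℤ`. -/
abbrev S1 : Type := UnitAddCircle

/-- `F` is a lift of the circle homeomorphism `f` to the real line. A unit of `CircleDeg1Lift` is an
increasing homeomorphism of `ℝ` commuting with the integer translations. -/
def IsLift (F : CircleDeg1Liftˣ) (f : S1 ≃ₜ S1) : Prop :=
  ∀ x : ℝ, f (x : S1) = ((F x : ℝ) : S1)

theorem IsLift.one : IsLift 1 1 := fun _ => rfl

theorem IsLift.mul {F G : CircleDeg1Liftˣ} {f g : S1 ≃ₜ S1} (hF : IsLift F f) (hG : IsLift G g) :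
    IsLift (F * G) (f * g) := fun x => by
  change f (g (x : S1)) = ((F (G x) : ℝ) : S1)
  rw [hG x, hF (G x)]

theorem IsLift.inv {F : CircleDeg1Liftˣ} {f : S1 ≃ₜ S1} (hF : IsLift F f) :
    IsLift F⁻¹ f⁻¹ := fun x => by
  change f.symm (x : S1) = _
  rw [Homeomorph.symm_apply_eq, hF, CircleDeg1Lift.units_apply_inv_apply]

/-- The group of orientation-preserving homeomorphisms of the circle. -/
def HomeoPlus : Subgroup (S1 ≃ₜ S1) where
  carrier := {f | ∃ F : CircleDeg1Liftˣ, IsLift F f}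
  one_mem' := ⟨1, IsLift.one⟩
  mul_mem' := by
    rintro f g ⟨F, hF⟩ ⟨G, hG⟩
    exact ⟨F * G, hF.mul hG⟩
  inv_mem' := by
    rintro f ⟨F, hF⟩
    exact ⟨F⁻¹, hF.inv⟩

/-- The natural action on the circle; subgroups of `HomeoPlus` inherit it. -/
instance : MulAction HomeoPlus S1 where
  smul f x := (f : S1 ≃ₜ S1) x
  one_smul _ := rfl
  mul_smul _ _ _ := rfl

/-- A chosen lift. Any two lifts differ by an integer translation (`IsLift.exists_int`), so the
notions below do not depend on the choice. -/
noncomputable def lift (f : HomeoPlus) : CircleDeg1Liftˣ := f.2.choose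

theorem isLift_lift (f : HomeoPlus) : IsLift (lift f) f := f.2.choose_spec

theorem IsLift.exists_int {F G : CircleDeg1Liftˣ} {f : S1 ≃ₜ S1} (hF : IsLift F f)
    (hG : IsLift G f) : ∃ n : ℤ, ∀ x : ℝ, F x = G x + n := by
  have h : ∀ x : ℝ, ∃ n : ℤ, F x - G x = n := fun x => by
    have h1 : ((F x : ℝ) : S1) = ((G x : ℝ) : S1) := (hF x).symm.trans (hG x)
    obtain ⟨n, hn⟩ := (AddCircle.coe_eq_zero_iff (1 : ℝ) (x := F x - G x)).1 (by
      rw [AddCircle.coe_sub, h1, sub_self])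
    exact ⟨n, by rw [← hn]; simp⟩
  choose n hn using h
  have hFc : Continuous (F : ℝ → ℝ) := (CircleDeg1Lift.toOrderIso F).continuous
  have hGc : Continuous (G : ℝ → ℝ) := (CircleDeg1Lift.toOrderIso G).continuous
  have hc : Continuous n := by
    rw [Int.isClosedEmbedding_coe_real.isEmbedding.continuous_iff]
    have : ((fun m : ℤ => (m : ℝ)) ∘ n) = fun x => F x - G x := by
      funext x; exact (hn x).symm
    rw [this]
    exact hFc.sub hGc
  refine ⟨n 0, fun x => ?_⟩
  have h0 : n x = n 0 := PreconnectedSpace.constant inferInstance hc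
  rw [← h0, ← hn x]
  ring

/-- The rotation number, in `ℝ/ℤ`: the class of the translation number of a lift. -/
noncomputable def rotationNumber (f : HomeoPlus) : UnitAddCircle :=
  ((CircleDeg1Lift.translationNumber (lift f) : ℝ) : UnitAddCircle)

theorem IsLift.rotationNumber_eq {F : CircleDeg1Liftˣ} {f : HomeoPlus} (hF : IsLift F f) :
    rotationNumber f = ((CircleDeg1Lift.translationNumber F : ℝ) : UnitAddCircle) := by
  obtain ⟨n, hn⟩ := (isLift_lift f).exists_int hF
  have h : (lift f : CircleDeg1Lift) =
      (CircleDeg1Lift.translate (Multiplicative.ofAdd (n : ℝ)) : CircleDeg1Lift) * F := by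
    ext x
    rw [CircleDeg1Lift.mul_apply, CircleDeg1Lift.translate_apply, hn x, add_comm]
  have hc : Commute (CircleDeg1Lift.translate (Multiplicative.ofAdd (n : ℝ)) : CircleDeg1Lift)
      (F : CircleDeg1Lift) := by
    rw [CircleDeg1Lift.commute_iff_commute]
    intro x
    simp [CircleDeg1Lift.translate_apply]
  rw [rotationNumber, h, CircleDeg1Lift.translationNumber_mul_of_commute hc,
    CircleDeg1Lift.translationNumber_translate, AddCircle.coe_add]
  have h0 : ((n : ℝ) : UnitAddCircle) = 0 :=
    (AddCircle.coe_eq_zero_iff (1 : ℝ)).2 ⟨n, by simp⟩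
  rw [h0, zero_add]

/-- The group of orientation-preserving `C^∞` diffeomorphisms of the circle. -/
def DiffPlus : Subgroup HomeoPlus where
  carrier := {f | ∃ F : CircleDeg1Liftˣ, IsLift F f ∧ ContDiff ℝ ∞ (F : ℝ → ℝ) ∧
    ContDiff ℝ ∞ ((F⁻¹ : CircleDeg1Liftˣ) : ℝ → ℝ)}
  one_mem' := ⟨1, IsLift.one, contDiff_id, by rw [inv_one]; exact contDiff_id⟩
  mul_mem' := by
    rintro f g ⟨F, hF, hF1, hF2⟩ ⟨G, hG, hG1, hG2⟩
    refine ⟨F * G, hF.mul hG, hF1.comp hG1, ?_⟩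
    rw [mul_inv_rev]
    exact hG2.comp hF2
  inv_mem' := by
    rintro f ⟨F, hF, hF1, hF2⟩
    refine ⟨F⁻¹, hF.inv, hF2, ?_⟩
    rw [inv_inv]
    exact hF1

/-- The `C^r`-topology on the group of `C^∞` diffeomorphisms, `0 ≤ r ≤ ∞`: uniform convergence of
the maps and of the derivatives (computed in lifts) of every finite order `k ≤ r`. -/
noncomputable abbrev crTopology (r : ℕ∞) : TopologicalSpace DiffPlus :=
  TopologicalSpace.induced
      (fun f : DiffPlus => UniformFun.ofFun (fun x : S1 => f • x)) inferInstance ⊓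
    ⨅ (k : ℕ) (_ : 1 ≤ k) (_ : (k : ℕ∞) ≤ r),
      TopologicalSpace.induced
        (fun f : DiffPlus => UniformFun.ofFun (iteratedDeriv k (lift (f : HomeoPlus) : ℝ → ℝ)))
        inferInstance

/-- `Γ` is discrete with respect to the `C^r`-topology. -/
def IsCrDiscrete (r : ℕ∞) (Γ : Subgroup DiffPlus) : Prop :=
  @DiscreteTopology Γ ((crTopology r).induced (fun γ : Γ => (γ : DiffPlus)))

/-- The image of `Γ` under the rotation number function. -/
noncomputable def rotationImage (Γ : Subgroup DiffPlus) : Set UnitAddCircle :=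
  (fun f : DiffPlus => rotationNumber (f : HomeoPlus)) '' (Γ : Set DiffPlus)

/-- `Γ` has a finite orbit in the circle. -/
def HasFiniteOrbit (Γ : Subgroup DiffPlus) : Prop :=
  ∃ x : S1, (MulAction.orbit Γ x).Finite

/-- `C` is an exceptional minimal set of `Γ`: a nonempty closed invariant set, in which every orbit
is dense, and which is homeomorphic to the Cantor set. -/
structure IsExceptionalMinimalSet (Γ : Subgroup DiffPlus) (C : Set S1) : Prop where
  nonempty : C.Nonempty
  isClosed : IsClosed C
  invariant : ∀ γ ∈ Γ, ∀ x ∈ C, γ • x ∈ C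
  minimal : ∀ x ∈ C, C ⊆ closure (MulAction.orbit Γ x)
  cantor : Nonempty (C ≃ₜ cantorSet)

theorem cos_sin_ne_zero (θ : ℝ) : ![Real.cos θ, Real.sin θ] ≠ (0 : Fin 2 → ℝ) := fun h => by
  have h0 : Real.cos θ = 0 := congrFun h 0
  have h1 : Real.sin θ = 0 := congrFun h 1
  have h2 := Real.sin_sq_add_cos_sq θ
  rw [h0, h1] at h2
  norm_num at h2

/-- The line through `(cos πx, sin πx)`, a point of the real projective line. -/
noncomputable def projPoint (x : ℝ) : Projectivization ℝ (Fin 2 → ℝ) :=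
  Projectivization.mk ℝ ![Real.cos (Real.pi * x), Real.sin (Real.pi * x)] (cos_sin_ne_zero _)

/-- `f` is the action of the matrix `A` on the real projective line, under the identification
`x ↦ projPoint x` of `ℝ/ℤ` with the projective line. -/
def IsProjectiveMap (A : Matrix.SpecialLinearGroup (Fin 2) ℝ) (f : DiffPlus) : Prop :=
  ∀ x y : ℝ, f • (x : S1) = (y : S1) → A • projPoint x = projPoint y

/-- `Γ` is a Fuchsian group: the group of circle diffeomorphisms given by a discrete subgroup of
`PSL(2, ℝ)`, the latter being presented as the image of a discrete subgroup of `SL(2, ℝ)`. -/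
def IsFuchsian (Γ : Subgroup DiffPlus) : Prop :=
  ∃ Λ : Subgroup (Matrix.SpecialLinearGroup (Fin 2) ℝ), DiscreteTopology Λ ∧
    ∀ f : DiffPlus, f ∈ Γ ↔ ∃ A ∈ Λ, IsProjectiveMap A f

/-- A `C^∞` vector field on the circle `ℝ/ℤ`, written as the coefficient of `d/dx`. -/
def IsSmoothVectorField (X : S1 → ℝ) : Prop :=
  ContDiff ℝ ∞ (fun x : ℝ => X (x : S1))

/-- `f` is the time `t` map of the flow of the vector field `X`. -/
def IsFlowMap (X : S1 → ℝ) (t : ℝ) (f : DiffPlus) : Prop :=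
  ∀ x : ℝ, ∃ c : ℝ → ℝ, c 0 = x ∧ (∀ s : ℝ, HasDerivAt c (X (c s : S1)) s) ∧
    f • (x : S1) = ((c t : ℝ) : S1)

/-- `Γ` contains a subgroup isomorphic to `ℤ ⊕ ℤ`. -/
def ContainsZSquared (Γ : Subgroup DiffPlus) : Prop :=
  ∃ H : Subgroup DiffPlus, H ≤ Γ ∧ Nonempty (H ≃* Multiplicative (ℤ × ℤ))

/-- `Γ` contains an infinite cyclic subgroup of finite index. -/
def ContainsInfiniteCyclicFiniteIndex (Γ : Subgroup DiffPlus) : Prop :=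
  ∃ c ∈ Γ, ¬ IsOfFinOrder c ∧ (Subgroup.zpowers c).relIndex Γ ≠ 0

/-- `Γ` contains a nonabelian free subgroup. -/
def ContainsNonabelianFree (Γ : Subgroup DiffPlus) : Prop :=
  ∃ H : Subgroup DiffPlus, H ≤ Γ ∧ IsFreeGroup H ∧ ∃ a ∈ H, ∃ b ∈ H, a * b ≠ b * a

/-- The data of the construction: a finitely generated torsion-free Fuchsian group `Γ₁` with
exceptional minimal set `C`, a connected component `I` of the complement of `C`, a nontrivial `C^∞`
vector field `X` vanishing outside `I`, and a dense subgroup `Γ₂`, isomorphic to `ℤ ⊕ ℤ`, of the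
flow of `X`. -/
structure IsConstruction (Γ₁ : Subgroup DiffPlus) (C I : Set S1) (X : S1 → ℝ)
    (Γ₂ : Subgroup DiffPlus) : Prop where
  fuchsian : IsFuchsian Γ₁
  fg : Γ₁.FG
  torsionFree : ∀ γ ∈ Γ₁, IsOfFinOrder γ → γ = 1
  exceptional : IsExceptionalMinimalSet Γ₁ C
  component : ∃ x ∈ Cᶜ, I = connectedComponentIn Cᶜ x
  smooth : IsSmoothVectorField X
  nontrivial : X ≠ 0
  vanish : ∀ x ∉ I, X x = 0
  zSquared : Nonempty (Γ₂ ≃* Multiplicative (ℤ × ℤ))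
  flow : ∀ g ∈ Γ₂, ∃ t : ℝ, IsFlowMap X t g
  dense : Dense {t : ℝ | ∃ g ∈ Γ₂, IsFlowMap X t g}

end CircleDiff

open CircleDiff

namespace CircleDiff

/-! The two groups live on disjoint parts of the circle. The field X vanishes on C, so Γ₂ fixes C
pointwise and every element of the generated group acts on C as some element of Γ₁
(`exists_agree_of_mem_sup`). A rotation number can be read off along one orbit inside C
(`rotationNumber_eq_of_agree`), so only Γ₁ matters for it. A nontrivial element of a torsion-free
Fuchsian group is not elliptic, hence has a fixed point and rotation number zero
(`exists_fixed_of_isFuchsian`). A finite orbit of Γ₁ could be pushed monotonically onto C, where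
minimality forbids it (`exists_finite_orbit_mem`).

The behaviour impossible for analytic maps comes from Γ₂, which lives in one gap of C. Its times
accumulate at 0, and the flow tends to the identity with all derivatives (`tendsto_flowDiff`), while
a flow with a zero and a moving point has no nonzero period (`eq_zero_of_flowDiff_eq_one`). This
gives nondiscreteness. The group ℤ ⊕ ℤ is neither finite nor virtually cyclic and has no nonabelian
subgroup, so one instance of the data refutes all three assertions.

For existence, Γ₁ is generated by the unipotent matrices with off-diagonal entry 3. It lies in SL(2,
ℤ), hence is discrete, and in the congruence subgroup of level 3, where traces exclude elliptic
elements (`two_le_abs_trace`). Ping-pong keeps the orbit of 0 out of an open set, so a minimal set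
inside its closure is proper, perfect and without interior (`exists_isExceptionalMinimalSet`), and
such a set is a Cantor set (`nonempty_homeomorph_of_perfect`). Γ₂ is the set of time m + n√2 maps of
the flow of a bump field. -/

/-! ### Lifts of circle maps and rotation numbers. -/

theorem coe_eq_coe_iff {x y : ℝ} : (x : S1) = (y : S1) ↔ ∃ n : ℤ, x = y + n := by
  constructor
  · intro h
    obtain ⟨n, hn⟩ := (AddCircle.coe_eq_zero_iff (1 : ℝ) (x := x - y)).1 (by
      rw [AddCircle.coe_sub, h, sub_self])
    exact ⟨n, by simp at hn; linarith⟩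
  · rintro ⟨n, rfl⟩
    have h0 : ((n : ℝ) : S1) = 0 := (AddCircle.coe_eq_zero_iff (1 : ℝ)).2 ⟨n, by simp⟩
    rw [AddCircle.coe_add, h0, add_zero]

theorem exists_coe_eq (p : S1) : ∃ x : ℝ, (x : S1) = p :=
  QuotientAddGroup.mk_surjective p

theorem continuous_of_coe {Y : Type*} [TopologicalSpace Y] {f : S1 → Y}
    (h : Continuous fun x : ℝ => f (x : S1)) : Continuous f :=
  (QuotientAddGroup.isQuotientMap_mk (N := AddSubgroup.zmultiples (1 : ℝ))).continuous_iff.2 h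

theorem continuous_coe_S1 : Continuous (fun x : ℝ => (x : S1)) := AddCircle.continuous_mk' 1

/-- The circle map induced by a degree one lift. -/
noncomputable def circleMap (F : CircleDeg1Liftˣ) : S1 → S1 :=
  Function.Periodic.lift (f := fun x : ℝ => ((F x : ℝ) : S1)) (c := 1) fun x =>
    coe_eq_coe_iff.2 ⟨1, by simp⟩

theorem circleMap_coe (F : CircleDeg1Liftˣ) (x : ℝ) : circleMap F (x : S1) = ((F x : ℝ) : S1) :=
  Function.Periodic.lift_coe _ x

theorem continuous_lift_coe (F : CircleDeg1Liftˣ) : Continuous (F : ℝ → ℝ) :=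
  (CircleDeg1Lift.toOrderIso F).continuous

theorem strictMono_lift_coe (F : CircleDeg1Liftˣ) : StrictMono (F : ℝ → ℝ) :=
  (CircleDeg1Lift.toOrderIso F).strictMono

theorem continuous_circleMap (F : CircleDeg1Liftˣ) : Continuous (circleMap F) :=
  continuous_of_coe (by
    simp only [circleMap_coe]
    exact continuous_coe_S1.comp (continuous_lift_coe F))

/-- The circle homeomorphism induced by a degree one lift. -/
noncomputable def homeoOfLift (F : CircleDeg1Liftˣ) : S1 ≃ₜ S1 where
  toFun := circleMap F
  invFun := circleMap F⁻¹
  left_inv p := by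
    obtain ⟨x, rfl⟩ := exists_coe_eq p
    rw [circleMap_coe, circleMap_coe, CircleDeg1Lift.units_inv_apply_apply]
  right_inv p := by
    obtain ⟨x, rfl⟩ := exists_coe_eq p
    rw [circleMap_coe, circleMap_coe, CircleDeg1Lift.units_apply_inv_apply]
  continuous_toFun := continuous_circleMap F
  continuous_invFun := continuous_circleMap F⁻¹

theorem isLift_homeoOfLift (F : CircleDeg1Liftˣ) : IsLift F (homeoOfLift F) := circleMap_coe F

/-- The circle diffeomorphism induced by a smooth lift with smooth inverse. -/
noncomputable def diffOfLift (F : CircleDeg1Liftˣ) (h : ContDiff ℝ ∞ (F : ℝ → ℝ))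
    (h' : ContDiff ℝ ∞ ((F⁻¹ : CircleDeg1Liftˣ) : ℝ → ℝ)) : DiffPlus :=
  ⟨⟨homeoOfLift F, F, isLift_homeoOfLift F⟩, F, isLift_homeoOfLift F, h, h'⟩

theorem diffOfLift_smul (F : CircleDeg1Liftˣ) (h h') (x : ℝ) :
    diffOfLift F h h' • (x : S1) = ((F x : ℝ) : S1) := circleMap_coe F x

theorem IsLift.smul_coe {F : CircleDeg1Liftˣ} {f : DiffPlus}
    (h : IsLift F (f : HomeoPlus)) (x : ℝ) : f • (x : S1) = ((F x : ℝ) : S1) := h x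

theorem exists_isLift (f : DiffPlus) : ∃ F : CircleDeg1Liftˣ, IsLift F (f : HomeoPlus) :=
  f.1.2

theorem diffPlus_ext {f g : DiffPlus} (h : ∀ p : S1, f • p = g • p) : f = g :=
  Subtype.ext (Subtype.ext (Homeomorph.ext h))

theorem continuous_smul_S1 (f : DiffPlus) : Continuous fun p : S1 => f • p :=
  f.1.1.continuous

theorem IsLift.pow {F : CircleDeg1Liftˣ} {f : DiffPlus} (h : IsLift F (f : HomeoPlus)) (n : ℕ) :
    IsLift (F ^ n) ((f ^ n : DiffPlus) : HomeoPlus) := by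
  induction n with
  | zero => exact IsLift.one
  | succ n ih => rw [pow_succ, pow_succ]; exact ih.mul h

/-- Integer translation of a lift. -/
noncomputable def translateLift (F : CircleDeg1Liftˣ) (n : ℤ) : CircleDeg1Liftˣ :=
  CircleDeg1Lift.translate (Multiplicative.ofAdd (n : ℝ)) * F

theorem translateLift_apply (F : CircleDeg1Liftˣ) (n : ℤ) (x : ℝ) :
    translateLift F n x = F x + n := by
  simp [translateLift, CircleDeg1Lift.translate_apply, add_comm]

theorem IsLift.translate {F : CircleDeg1Liftˣ} {f : S1 ≃ₜ S1} (h : IsLift F f) (n : ℤ) :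
    IsLift (translateLift F n) f := fun x => by
  rw [h x, translateLift_apply]
  exact (coe_eq_coe_iff.2 ⟨n, rfl⟩).symm

/-- A lift with a prescribed value at one point. -/
theorem exists_isLift_apply_eq (f : DiffPlus) {x y : ℝ} (h : f • (x : S1) = (y : S1)) :
    ∃ F : CircleDeg1Liftˣ, IsLift F (f : HomeoPlus) ∧ F x = y := by
  obtain ⟨F, hF⟩ := exists_isLift f
  rw [hF.smul_coe] at h
  obtain ⟨n, hn⟩ := coe_eq_coe_iff.1 h
  exact ⟨translateLift F (-n), hF.translate _, by rw [translateLift_apply, hn]; simp⟩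

theorem rotationNumber_eq_zero_of_fixed {f : DiffPlus} {p : S1} (h : f • p = p) :
    rotationNumber (f : HomeoPlus) = 0 := by
  obtain ⟨x, rfl⟩ := exists_coe_eq p
  obtain ⟨F, hF, hx⟩ := exists_isLift_apply_eq f h
  rw [hF.rotationNumber_eq, CircleDeg1Lift.translationNumber_of_eq_add_int F (x := x) (m := 0)
    (by simpa using hx)]
  simp

/-- A lift fixing one point has an iterate equal to the identity of the line. If it moved some
point, monotonicity would make the iterates of that point drift in one direction and never return.
-/
theorem eq_one_of_isOfFinOrder_of_fixed {f : DiffPlus} {p : S1} (h : f • p = p)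
    (hf : IsOfFinOrder f) : f = 1 := by
  obtain ⟨n, hn, hfn⟩ := isOfFinOrder_iff_pow_eq_one.1 hf
  obtain ⟨x, rfl⟩ := exists_coe_eq p
  obtain ⟨F, hF, hx⟩ := exists_isLift_apply_eq f h
  have hit : ∀ (k : ℕ) (y : ℝ), (F ^ k : CircleDeg1Liftˣ) y = (F : ℝ → ℝ)^[k] y := fun k y => by
    rw [Units.val_pow_eq_pow_val, CircleDeg1Lift.coe_pow]
  have h1 : IsLift (F ^ n) ((1 : DiffPlus) : HomeoPlus) := hfn ▸ hF.pow n
  obtain ⟨m, hm⟩ := h1.exists_int (IsLift.one)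
  have hm0 : (m : ℝ) = 0 := by
    have := hm x
    rw [hit, Function.iterate_fixed hx] at this
    simpa using this
  have hid : ∀ y : ℝ, (F : ℝ → ℝ)^[n] y = y := fun y => by
    rw [← hit, hm y, hm0]; simp
  have hmono := strictMono_lift_coe F
  have hFid : ∀ y : ℝ, F y = y := fun y => by
    rcases lt_trichotomy (F y) y with hlt | heq | hgt
    · have := hmono.monotone.antitone_iterate_of_map_le hlt.le (Nat.succ_le_of_lt hn)
      simp only [Nat.succ_eq_add_one, zero_add, Function.iterate_one] at this
      rw [hid] at this
      exact absurd hlt (not_lt.2 this)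
    · exact heq
    · have := hmono.monotone.monotone_iterate_of_le_map hgt.le (Nat.succ_le_of_lt hn)
      simp only [Nat.succ_eq_add_one, zero_add, Function.iterate_one] at this
      rw [hid] at this
      exact absurd hgt (not_lt.2 this)
  refine diffPlus_ext fun q => ?_
  obtain ⟨y, rfl⟩ := exists_coe_eq q
  rw [hF.smul_coe, hFid, one_smul]

/-- On a period starting at x₀ the values of both lifts stay in the same half-open unit interval, so
their integer difference vanishes. No continuity is involved, since C may be totally disconnected.
-/
theorem lift_eq_of_agree {C : Set S1} {F G : CircleDeg1Liftˣ}
    (h : ∀ x : ℝ, (x : S1) ∈ C → ((F x : ℝ) : S1) = ((G x : ℝ) : S1)) {x₀ : ℝ}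
    (h₀ : F x₀ = G x₀) : ∀ x : ℝ, (x : S1) ∈ C → F x = G x := by
  have key : ∀ x : ℝ, x₀ ≤ x → x < x₀ + 1 → (x : S1) ∈ C → F x = G x := fun x h1 h2 hx => by
    obtain ⟨n, hn⟩ := coe_eq_coe_iff.1 (h x hx)
    have a1 := (strictMono_lift_coe F).monotone h1
    have a2 := (strictMono_lift_coe F) h2
    have b1 := (strictMono_lift_coe G).monotone h1
    have b2 := (strictMono_lift_coe G) h2
    rw [CircleDeg1Lift.map_add_one] at a2 b2
    have c1 : (n : ℝ) < 1 := by linarith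
    have c2 : (-1 : ℝ) < n := by linarith
    have : n = 0 := by
      have c1' : n < 1 := by exact_mod_cast c1
      have c2' : -1 < n := by exact_mod_cast c2
      omega
    rw [hn, this]; simp
  intro x hx
  have h3 := Int.floor_le (x - x₀)
  have h4 := Int.lt_floor_add_one (x - x₀)
  have h5 := key (x - ⌊x - x₀⌋) (by linarith) (by linarith) (by
    have : ((x - ⌊x - x₀⌋ : ℝ) : S1) = (x : S1) :=
      coe_eq_coe_iff.2 ⟨-⌊x - x₀⌋, by push_cast; ring⟩
    rwa [this])
  rw [CircleDeg1Lift.map_sub_int, CircleDeg1Lift.map_sub_int] at h5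
  linarith

/-- Translation numbers may be computed from any starting point. From a point over C, suitable lifts
have identical orbits. -/
theorem rotationNumber_eq_of_agree {C : Set S1} (hC : C.Nonempty) {f g : DiffPlus}
    (hinv : ∀ p ∈ C, g • p ∈ C) (h : ∀ p ∈ C, f • p = g • p) :
    rotationNumber (f : HomeoPlus) = rotationNumber (g : HomeoPlus) := by
  obtain ⟨p, hp⟩ := hC
  obtain ⟨x₀, rfl⟩ := exists_coe_eq p
  obtain ⟨G, hG⟩ := exists_isLift g
  obtain ⟨F, hF, hFG⟩ := exists_isLift_apply_eq f (x := x₀) (y := G x₀)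
    (by rw [h _ hp, hG.smul_coe])
  have hag := lift_eq_of_agree (C := C) (fun x hx => by
    rw [← hF.smul_coe, ← hG.smul_coe, h _ hx]) hFG
  have hit : ∀ k : ℕ, (F : ℝ → ℝ)^[k] x₀ = (G : ℝ → ℝ)^[k] x₀ ∧
      (((G : ℝ → ℝ)^[k] x₀ : ℝ) : S1) ∈ C := fun k => by
    induction k with
    | zero => exact ⟨rfl, hp⟩
    | succ k ih =>
      rw [Function.iterate_succ_apply', Function.iterate_succ_apply', ih.1]
      exact ⟨hag _ ih.2, by rw [← hG.smul_coe]; exact hinv _ ih.2⟩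
  rw [hF.rotationNumber_eq, hG.rotationNumber_eq]
  congr 1
  have h1 := CircleDeg1Lift.tendsto_translationNumber (F : CircleDeg1Lift) x₀
  have h2 := CircleDeg1Lift.tendsto_translationNumber (G : CircleDeg1Lift) x₀
  refine tendsto_nhds_unique h1 (h2.congr fun n => ?_)
  rw [CircleDeg1Lift.coe_pow, CircleDeg1Lift.coe_pow, (hit n).1]

end CircleDiff

namespace CircleDiff

/-! ### Projective maps, and fixed points of elements of torsion-free Fuchsian groups. -/

theorem mk_eq_mk_iff_cross {v w : Fin 2 → ℝ} (hv : v ≠ 0) (hw : w ≠ 0) :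
    Projectivization.mk ℝ v hv = Projectivization.mk ℝ w hw ↔ v 0 * w 1 = v 1 * w 0 := by
  rw [Projectivization.mk_eq_mk_iff']
  constructor
  · rintro ⟨a, rfl⟩
    simp only [Pi.smul_apply, smul_eq_mul]
    ring
  · intro h
    by_cases h0 : w 0 = 0
    · have h1 : w 1 ≠ 0 := fun h1 => hw (by ext i; fin_cases i <;> assumption)
      have hv0 : v 0 = 0 := by
        rw [h0, mul_zero] at h
        exact (mul_eq_zero.1 h).resolve_right h1
      refine ⟨v 1 / w 1, ?_⟩
      ext i
      fin_cases i
      · simp [h0, hv0]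
      · simp [h1]
    · refine ⟨v 0 / w 0, ?_⟩
      ext i
      fin_cases i
      · simp [h0]
      · change v 0 / w 0 * w 1 = v 1
        field_simp
        linarith

theorem projPoint_eq_iff {x y : ℝ} : projPoint x = projPoint y ↔ (x : S1) = (y : S1) := by
  rw [projPoint, projPoint, mk_eq_mk_iff_cross]
  simp only [Matrix.cons_val_zero, Matrix.cons_val_one]
  have h : Real.cos (Real.pi * x) * Real.sin (Real.pi * y) =
      Real.sin (Real.pi * x) * Real.cos (Real.pi * y) ↔ Real.sin (Real.pi * (x - y)) = 0 := by
    rw [mul_sub, Real.sin_sub]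
    constructor <;> intro h <;> linarith
  rw [h, Real.sin_eq_zero_iff, coe_eq_coe_iff]
  refine exists_congr fun n => ?_
  rw [mul_comm, mul_right_inj' Real.pi_ne_zero]
  constructor <;> intro h <;> linarith

theorem exists_projPoint_eq {v : Fin 2 → ℝ} (hv : v ≠ 0) :
    ∃ x : ℝ, projPoint x = Projectivization.mk ℝ v hv := by
  refine ⟨(⟨v 0, v 1⟩ : ℂ).arg / Real.pi, ?_⟩
  rw [projPoint, mk_eq_mk_iff_cross, mul_div_cancel₀ _ Real.pi_ne_zero]
  have hz : (⟨v 0, v 1⟩ : ℂ) ≠ 0 := fun h => hv (by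
    ext i
    fin_cases i
    · exact congrArg Complex.re h
    · exact congrArg Complex.im h)
  simp only [Matrix.cons_val_zero, Matrix.cons_val_one]
  rw [Complex.cos_arg hz, Complex.sin_arg]
  ring

theorem IsProjectiveMap.mul {A B : Matrix.SpecialLinearGroup (Fin 2) ℝ} {f g : DiffPlus}
    (hf : IsProjectiveMap A f) (hg : IsProjectiveMap B g) : IsProjectiveMap (A * B) (f * g) := by
  intro x y h
  obtain ⟨z, hz⟩ := exists_coe_eq (g • (x : S1))
  rw [mul_smul, hg x z hz.symm, hf z y (by rw [hz, ← mul_smul, h])]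

theorem IsProjectiveMap.one : IsProjectiveMap 1 1 := fun x y h => by
  rw [one_smul] at h ⊢
  exact projPoint_eq_iff.2 h

theorem IsProjectiveMap.pow {A : Matrix.SpecialLinearGroup (Fin 2) ℝ} {f : DiffPlus}
    (hf : IsProjectiveMap A f) (n : ℕ) : IsProjectiveMap (A ^ n) (f ^ n) := by
  induction n with
  | zero => exact IsProjectiveMap.one
  | succ n ih => rw [pow_succ, pow_succ]; exact ih.mul hf

theorem IsProjectiveMap.unique {A : Matrix.SpecialLinearGroup (Fin 2) ℝ} {f g : DiffPlus}
    (hf : IsProjectiveMap A f) (hg : IsProjectiveMap A g) : f = g := by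
  refine diffPlus_ext fun p => ?_
  obtain ⟨x, rfl⟩ := exists_coe_eq p
  obtain ⟨y, hy⟩ := exists_coe_eq (f • (x : S1))
  obtain ⟨z, hz⟩ := exists_coe_eq (g • (x : S1))
  rw [← hy, ← hz]
  exact projPoint_eq_iff.1 ((hf x y hy.symm).symm.trans (hg x z hz.symm))

theorem IsProjectiveMap.smul_eq_of_eigenvector {A : Matrix.SpecialLinearGroup (Fin 2) ℝ}
    {f : DiffPlus} (hf : IsProjectiveMap A f) {v : Fin 2 → ℝ} (hv : v ≠ 0) {c : ℝ}
    (hc : A.1.mulVec v = c • v) : ∃ p : S1, f • p = p := by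
  obtain ⟨x, hx⟩ := exists_projPoint_eq hv
  obtain ⟨y, hy⟩ := exists_coe_eq (f • (x : S1))
  have h := hf x y hy.symm
  refine ⟨x, ?_⟩
  rw [← hy]
  refine projPoint_eq_iff.1 ?_
  rw [← h, hx, Projectivization.smul_mk, mk_eq_mk_iff_cross]
  have : A • v = c • v := hc
  rw [this]
  simp only [Pi.smul_apply, smul_eq_mul]
  ring

theorem det_fin_two_eq_one (A : Matrix.SpecialLinearGroup (Fin 2) ℝ) :
    A 0 0 * A 1 1 - A 0 1 * A 1 0 = 1 := by
  have := A.2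
  rwa [Matrix.det_fin_two] at this

/-- A matrix of determinant one whose trace is at least two in absolute value has a real
eigenvector. -/
theorem exists_eigenvector_of_two_le_abs_trace (A : Matrix.SpecialLinearGroup (Fin 2) ℝ)
    (h : 2 ≤ |A 0 0 + A 1 1|) : ∃ v : Fin 2 → ℝ, v ≠ 0 ∧ ∃ c : ℝ, A.1.mulVec v = c • v := by
  have hdet := det_fin_two_eq_one A
  set a := A 0 0
  set b := A 0 1
  set c := A 1 0
  set d := A 1 1
  have hD : 0 ≤ (a + d) ^ 2 - 4 := by
    have : (2 : ℝ) ^ 2 ≤ |a + d| ^ 2 := by gcongr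
    rw [sq_abs] at this
    linarith
  set s := Real.sqrt ((a + d) ^ 2 - 4)
  have hs : s ^ 2 = (a + d) ^ 2 - 4 := Real.sq_sqrt hD
  set l := (a + d + s) / 2
  have hl : (l - a) * (l - d) = b * c := by
    have : l = (a + d + s) / 2 := rfl
    rw [this]
    nlinarith
  -- With l a root of the characteristic polynomial, both (b, l - a) and (l - d, c) are killed by A
  -- - l. If both vanish, A is scalar.
  by_cases hb : b = 0 ∧ l - a = 0
  · by_cases hc : c = 0 ∧ l - d = 0
    · refine ⟨![1, 0], fun h => by simpa using congrFun h 0, a, ?_⟩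
      ext i
      fin_cases i
      · simp [Matrix.mulVec, dotProduct, Fin.sum_univ_two, a]
      · simpa [Matrix.mulVec, dotProduct, Fin.sum_univ_two] using hc.1
    · have hne : ![l - d, c] ≠ 0 := fun h =>
        hc ⟨by simpa using congrFun h 1, by simpa using congrFun h 0⟩
      refine ⟨_, hne, l, ?_⟩
      ext i
      fin_cases i
      · change A.1.mulVec _ 0 = l * (l - d)
        simp only [Matrix.mulVec, dotProduct, Fin.sum_univ_two]
        change a * (l - d) + b * c = _
        linarith
      · change A.1.mulVec _ 1 = l * c
        simp only [Matrix.mulVec, dotProduct, Fin.sum_univ_two]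
        change c * (l - d) + d * c = _
        ring
  · refine ⟨![b, l - a],
      fun h => hb ⟨by simpa using congrFun h 0, by simpa using congrFun h 1⟩, l, ?_⟩
    ext i
    fin_cases i
    · change A.1.mulVec _ 0 = l * b
      simp only [Matrix.mulVec, dotProduct, Fin.sum_univ_two]
      change a * b + b * (l - a) = _
      ring
    · change A.1.mulVec _ 1 = l * (l - a)
      simp only [Matrix.mulVec, dotProduct, Fin.sum_univ_two]
      change c * b + d * (l - a) = _
      linarith

/-- The powers of an elliptic matrix have bounded entries. -/
theorem exists_bound_pow_of_abs_trace_lt_two (A : Matrix.SpecialLinearGroup (Fin 2) ℝ)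
    (h : |A 0 0 + A 1 1| < 2) : ∃ M : ℝ, ∀ (n : ℕ) (i j : Fin 2), |(A ^ n).1 i j| ≤ M := by
  set t := A 0 0 + A 1 1
  have ht := abs_lt.1 h
  set θ := Real.arccos (t / 2)
  have hcos : 2 * Real.cos θ = t := by
    rw [Real.cos_arccos (by linarith) (by linarith)]; ring
  have hsin : 0 < Real.sin θ := by
    rw [Real.sin_arccos]
    apply Real.sqrt_pos.2
    nlinarith
  have hCH : A.1 * A.1 = t • A.1 - 1 := by
    have hdet := det_fin_two_eq_one A
    ext i j
    fin_cases i <;> fin_cases j <;>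
      simp only [Matrix.mul_apply, Fin.sum_univ_two, Matrix.sub_apply, Matrix.smul_apply,
        smul_eq_mul, Fin.zero_eta, Fin.mk_one, Matrix.one_apply_eq, ne_eq, zero_ne_one,
        one_ne_zero, not_false_eq_true, Matrix.one_apply_ne, t] <;> linarith
  -- Since the trace is 2 cos θ, Cayley–Hamilton is the recurrence satisfied by n ↦ sin (nθ).
  have key : ∀ n : ℕ, Real.sin θ • (A ^ n).1 =
      Real.sin (n * θ) • A.1 - Real.sin (n * θ - θ) • (1 : Matrix (Fin 2) (Fin 2) ℝ) := fun n => by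
    induction n with
    | zero => simp
    | succ n ih =>
      rw [pow_succ, Matrix.SpecialLinearGroup.coe_mul, ← Matrix.smul_mul, ih, Matrix.sub_mul,
        Matrix.smul_mul, Matrix.smul_mul, hCH, one_mul, smul_sub, smul_smul, sub_right_comm,
        ← sub_smul, ← hcos]
      have e1 : Real.sin (n * θ) * (2 * Real.cos θ) - Real.sin (n * θ - θ) =
          Real.sin ((n + 1 : ℕ) * θ) := by
        rw [Nat.cast_succ, add_mul, one_mul, Real.sin_add, Real.sin_sub]; ring
      have e2 : (n + 1 : ℕ) * θ - θ = n * θ := by push_cast; ring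
      rw [e1, e2]
  refine ⟨((∑ i, ∑ j, |A.1 i j|) + 1) / Real.sin θ, fun n i j => ?_⟩
  rw [le_div_iff₀ hsin]
  have h1 : |(A ^ n).1 i j| * Real.sin θ =
      |Real.sin (n * θ) * A.1 i j - Real.sin (n * θ - θ) * (1 : Matrix (Fin 2) (Fin 2) ℝ) i j| := by
    have := congrFun (congrFun (key n) i) j
    simp only [Matrix.smul_apply, Matrix.sub_apply, smul_eq_mul] at this
    rw [← this, abs_mul, abs_of_pos hsin, mul_comm]
  rw [h1]
  refine (abs_sub _ _).trans ?_
  rw [abs_mul, abs_mul]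
  have h2 : |A.1 i j| ≤ ∑ i, ∑ j, |A.1 i j| :=
    (Finset.single_le_sum (f := fun j => |A.1 i j|) (fun _ _ => abs_nonneg _)
      (Finset.mem_univ j)).trans
      (Finset.single_le_sum (f := fun i => ∑ j, |A.1 i j|)
        (fun _ _ => Finset.sum_nonneg fun _ _ => abs_nonneg _) (Finset.mem_univ i))
  have h3 : |(1 : Matrix (Fin 2) (Fin 2) ℝ) i j| ≤ 1 := by
    rw [Matrix.one_apply]; split_ifs <;> simp
  have h4 := Real.abs_sin_le_one (n * θ)
  have h5 := Real.abs_sin_le_one (n * θ - θ)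
  have h6 := mul_le_mul h4 h2 (abs_nonneg _) zero_le_one
  have h7 := mul_le_mul h5 h3 (abs_nonneg _) zero_le_one
  linarith

/-- An element of a discrete group of matrices all of whose powers are bounded has finite order. -/
theorem exists_pow_eq_one_of_bounded {Λ : Subgroup (Matrix.SpecialLinearGroup (Fin 2) ℝ)}
    [DiscreteTopology Λ] {A : Matrix.SpecialLinearGroup (Fin 2) ℝ} (hA : A ∈ Λ) {M : ℝ}
    (hM : ∀ (n : ℕ) (i j : Fin 2), |(A ^ n).1 i j| ≤ M) : ∃ n : ℕ, 0 < n ∧ A ^ n = 1 := by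
  let K : Set (Matrix (Fin 2) (Fin 2) ℝ) :=
    {B | ∀ i j, B i j ∈ Set.Icc (-M) M} ∩ {B | B.det = 1}
  have hK1 : IsCompact {B : Matrix (Fin 2) (Fin 2) ℝ | ∀ i j, B i j ∈ Set.Icc (-M) M} := by
    have : IsCompact (Set.univ.pi fun _ : Fin 2 => Set.univ.pi fun _ : Fin 2 => Set.Icc (-M) M) :=
      isCompact_univ_pi fun _ => isCompact_univ_pi fun _ => isCompact_Icc
    have he : {B : Matrix (Fin 2) (Fin 2) ℝ | ∀ i j, B i j ∈ Set.Icc (-M) M} =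
        Set.univ.pi fun _ : Fin 2 => Set.univ.pi fun _ : Fin 2 => Set.Icc (-M) M :=
      Set.ext fun B => ⟨fun h i _ j _ => h i j, fun h i j => h i trivial j trivial⟩
    rw [he]
    exact this
  have : FirstCountableTopology (Matrix (Fin 2) (Fin 2) ℝ) :=
    inferInstanceAs (FirstCountableTopology (Fin 2 → Fin 2 → ℝ))
  have hK : IsCompact K := by
    refine hK1.inter_right (isClosed_eq ?_ continuous_const)
    exact Continuous.matrix_det continuous_id
  have hmem : ∀ n : ℕ, (A ^ n).1 ∈ K := fun n =>
    ⟨fun i j => abs_le.1 (hM n i j), (A ^ n).2⟩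
  obtain ⟨B, hB, φ, hφ, hlim⟩ := hK.tendsto_subseq hmem
  let B' : Matrix.SpecialLinearGroup (Fin 2) ℝ := ⟨B, hB.2⟩
  have hlim' : Filter.Tendsto (fun n => A ^ φ n) Filter.atTop (nhds B') :=
    tendsto_subtype_rng.2 hlim
  -- The limit of the powers need not be known to lie in Λ. Quotients of successive terms do lie in
  -- Λ and tend to 1, so discreteness makes one of them equal to 1.
  have h1 : Filter.Tendsto (fun n => (A ^ φ n)⁻¹ * A ^ φ (n + 1)) Filter.atTop (nhds 1) := by
    have := (hlim'.inv).mul (hlim'.comp (Filter.tendsto_add_atTop_nat 1))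
    rwa [inv_mul_cancel] at this
  let u : ℕ → Λ := fun n => ⟨(A ^ φ n)⁻¹ * A ^ φ (n + 1),
    Λ.mul_mem (Λ.inv_mem (Λ.pow_mem hA _)) (Λ.pow_mem hA _)⟩
  have h2 : Filter.Tendsto u Filter.atTop (nhds 1) := tendsto_subtype_rng.2 h1
  rw [nhds_discrete, Filter.tendsto_pure] at h2
  obtain ⟨n, hn⟩ := h2.exists
  have h3 : (A ^ φ n)⁻¹ * A ^ φ (n + 1) = 1 := congrArg Subtype.val hn
  have hlt : φ n < φ (n + 1) := hφ (Nat.lt_succ_self n)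
  refine ⟨φ (n + 1) - φ n, Nat.sub_pos_of_lt hlt, ?_⟩
  rw [pow_sub _ hlt.le, (Commute.refl A).pow_pow _ _ |>.inv_right.eq]
  exact h3

/-- Elements of a torsion-free Fuchsian group have a fixed point on the circle. -/
theorem exists_fixed_of_isFuchsian {Γ : Subgroup DiffPlus} (hΓ : IsFuchsian Γ)
    (htf : ∀ γ ∈ Γ, IsOfFinOrder γ → γ = 1) {γ : DiffPlus} (hγ : γ ∈ Γ) :
    ∃ p : S1, γ • p = p := by
  obtain ⟨Λ, hΛ, h⟩ := hΓ
  obtain ⟨A, hA, hAγ⟩ := (h γ).1 hγ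
  by_cases ht : 2 ≤ |A 0 0 + A 1 1|
  · obtain ⟨v, hv, c, hc⟩ := exists_eigenvector_of_two_le_abs_trace A ht
    exact hAγ.smul_eq_of_eigenvector hv hc
  -- In the elliptic case discreteness gives finite order, so γ is the identity and any point is
  -- fixed.
  · obtain ⟨M, hM⟩ := exists_bound_pow_of_abs_trace_lt_two A (not_le.1 ht)
    obtain ⟨n, hn, hAn⟩ := exists_pow_eq_one_of_bounded hA hM
    have h1 : γ ^ n = 1 := (hAn ▸ hAγ.pow n).unique IsProjectiveMap.one
    have := htf γ hγ (isOfFinOrder_iff_pow_eq_one.2 ⟨n, hn, h1⟩)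
    exact ⟨0, by rw [this, one_smul]⟩

/-! ### Pushing finite orbits into an invariant closed set. -/

section FirstPoint

/-- The first point of `C` at or after `x`. -/
noncomputable def firstPoint (C : Set S1) (x : ℝ) : ℝ :=
  sInf ({y : ℝ | (y : S1) ∈ C} ∩ Set.Ici x)

theorem isLeast_firstPoint {C : Set S1} (hC : C.Nonempty) (hC' : IsClosed C) (x : ℝ) :
    IsLeast ({y : ℝ | (y : S1) ∈ C} ∩ Set.Ici x) (firstPoint C x) := by
  have hcl : IsClosed ({y : ℝ | (y : S1) ∈ C} ∩ Set.Ici x) :=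
    (hC'.preimage continuous_coe_S1).inter isClosed_Ici
  refine hcl.isLeast_csInf ?_ ⟨x, fun y hy => hy.2⟩
  obtain ⟨p, hp⟩ := hC
  obtain ⟨y, rfl⟩ := exists_coe_eq p
  refine ⟨y + ⌈x - y⌉, ?_, ?_⟩
  · have : ((y + ⌈x - y⌉ : ℝ) : S1) = (y : S1) := coe_eq_coe_iff.2 ⟨_, rfl⟩
    change ((y + ⌈x - y⌉ : ℝ) : S1) ∈ C
    rwa [this]
  · have := Int.le_ceil (x - y)
    simp only [Set.mem_Ici]; linarith

/-- An increasing bijection preserving the preimage of C carries the first such point after x to the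
first one after the image of x. -/
theorem firstPoint_lift {C : Set S1} (hC : C.Nonempty) (hC' : IsClosed C) {F : CircleDeg1Liftˣ}
    (h1 : ∀ x : ℝ, (x : S1) ∈ C → ((F x : ℝ) : S1) ∈ C)
    (h2 : ∀ x : ℝ, (x : S1) ∈ C → (((F⁻¹ : CircleDeg1Liftˣ) x : ℝ) : S1) ∈ C) (x : ℝ) :
    firstPoint C (F x) = F (firstPoint C x) := by
  have hx := isLeast_firstPoint hC hC' x
  refine (isLeast_firstPoint hC hC' (F x)).unique ⟨⟨h1 _ hx.1.1,
    (strictMono_lift_coe F).monotone hx.1.2⟩, fun y hy => ?_⟩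
  have h3 : firstPoint C x ≤ (F⁻¹ : CircleDeg1Liftˣ) y := hx.2 ⟨h2 _ hy.1, by
    have := (strictMono_lift_coe F⁻¹).monotone hy.2
    rwa [CircleDeg1Lift.units_inv_apply_apply] at this⟩
  have := (strictMono_lift_coe F).monotone h3
  rwa [CircleDeg1Lift.units_apply_inv_apply] at this

/-- A group with a finite orbit has a finite orbit in every invariant nonempty closed set. -/
theorem exists_finite_orbit_mem {Γ : Subgroup DiffPlus} {C : Set S1} (hC : C.Nonempty)
    (hC' : IsClosed C) (hinv : ∀ γ ∈ Γ, ∀ p ∈ C, γ • p ∈ C) (h : HasFiniteOrbit Γ) :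
    ∃ p ∈ C, (MulAction.orbit Γ p).Finite := by
  obtain ⟨p, hp⟩ := h
  obtain ⟨x, rfl⟩ := exists_coe_eq p
  -- Applied to translation by 1, `firstPoint_lift` lets the first-point map descend to the circle.
  -- The descended map commutes with Γ, so it carries a finite orbit onto an orbit in C.
  have hper : Function.Periodic (fun x : ℝ => ((firstPoint C x : ℝ) : S1)) 1 := fun x => by
    have hT : ∀ y : ℝ, translateLift 1 1 y = y + 1 := fun y => by
      rw [translateLift_apply]; simp
    have hT' : ∀ y : ℝ, ((translateLift 1 1)⁻¹ : CircleDeg1Liftˣ) y = y - 1 := fun y => by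
      have := CircleDeg1Lift.units_inv_apply_apply (translateLift 1 1) (y - 1)
      rwa [hT, sub_add_cancel] at this
    have := firstPoint_lift hC hC' (F := translateLift 1 1)
      (fun y hy => by
        rw [hT, (coe_eq_coe_iff.2 ⟨1, by simp⟩ : ((y + 1 : ℝ) : S1) = (y : S1))]; exact hy)
      (fun y hy => by
        rw [hT', (coe_eq_coe_iff.2 ⟨-1, by simp; ring⟩ : ((y - 1 : ℝ) : S1) = (y : S1))]
        exact hy) x
    rw [hT, hT] at this
    simp only [this]
    exact coe_eq_coe_iff.2 ⟨1, by simp⟩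
  refine ⟨(firstPoint C x : S1), (isLeast_firstPoint hC hC' x).1.1,
    (hp.image hper.lift).subset ?_⟩
  rintro _ ⟨γ, rfl⟩
  refine ⟨γ • (x : S1), ⟨γ, rfl⟩, ?_⟩
  obtain ⟨F, hF⟩ := exists_isLift (γ : DiffPlus)
  change hper.lift ((γ : DiffPlus) • (x : S1)) = (γ : DiffPlus) • ((firstPoint C x : ℝ) : S1)
  rw [hF.smul_coe, hF.smul_coe, Function.Periodic.lift_coe, firstPoint_lift hC hC']
  · intro y hy
    rw [← hF.smul_coe]
    exact hinv _ γ.2 _ hy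
  · intro y hy
    have hF' : IsLift F⁻¹ (((γ : DiffPlus)⁻¹ : DiffPlus) : HomeoPlus) := hF.inv
    rw [← hF'.smul_coe]
    exact hinv _ (Γ.inv_mem γ.2) _ hy

end FirstPoint

theorem IsExceptionalMinimalSet.infinite {Γ : Subgroup DiffPlus} {C : Set S1}
    (h : IsExceptionalMinimalSet Γ C) : C.Infinite := by
  obtain ⟨e⟩ := h.cantor
  have : Infinite C := (e.trans cantorSetHomeomorphNatToBool).toEquiv.infinite_iff.2 inferInstance
  exact Set.infinite_coe_iff.1 this

/-- A finite orbit inside C would be closed and dense in C, whereas a Cantor set is infinite. -/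
theorem IsExceptionalMinimalSet.not_hasFiniteOrbit {Γ : Subgroup DiffPlus} {C : Set S1}
    (h : IsExceptionalMinimalSet Γ C) : ¬ HasFiniteOrbit Γ := fun hf => by
  obtain ⟨p, hp, hfin⟩ := exists_finite_orbit_mem h.nonempty h.isClosed h.invariant hf
  have := h.minimal p hp
  rw [hfin.isClosed.closure_eq] at this
  exact h.infinite (hfin.subset this)

theorem HasFiniteOrbit.mono {Γ Γ' : Subgroup DiffPlus} (hle : Γ' ≤ Γ) (h : HasFiniteOrbit Γ) :
    HasFiniteOrbit Γ' := by
  obtain ⟨p, hp⟩ := h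
  refine ⟨p, hp.subset ?_⟩
  rintro _ ⟨γ, rfl⟩
  exact ⟨⟨γ, hle γ.2⟩, rfl⟩

/-- If `Γ₂` fixes `C` pointwise, every element of `Γ₁ ⊔ Γ₂` agrees on `C` with an element of
`Γ₁`. -/
theorem exists_agree_of_mem_sup {Γ₁ Γ₂ : Subgroup DiffPlus} {C : Set S1}
    (h₁ : ∀ γ ∈ Γ₁, ∀ p ∈ C, γ • p ∈ C) (h₂ : ∀ g ∈ Γ₂, ∀ p ∈ C, g • p = p) {f : DiffPlus}
    (hf : f ∈ Γ₁ ⊔ Γ₂) : ∃ γ ∈ Γ₁, ∀ p ∈ C, f • p = γ • p := by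
  rw [← Subgroup.closure_eq Γ₁, ← Subgroup.closure_eq Γ₂, ← Subgroup.closure_union] at hf
  induction hf using Subgroup.closure_induction with
  | mem x hx =>
    rcases hx with hx | hx
    · exact ⟨x, hx, fun _ _ => rfl⟩
    · exact ⟨1, Γ₁.one_mem, fun p hp => by rw [h₂ x hx p hp, one_smul]⟩
  | one => exact ⟨1, Γ₁.one_mem, fun _ _ => rfl⟩
  | mul x y _ _ hx hy =>
    obtain ⟨a, ha, hxa⟩ := hx
    obtain ⟨b, hb, hyb⟩ := hy
    refine ⟨a * b, Γ₁.mul_mem ha hb, fun p hp => ?_⟩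
    rw [mul_smul, mul_smul, hyb p hp, hxa _ (h₁ b hb p hp)]
  | inv x _ hx =>
    obtain ⟨a, ha, hxa⟩ := hx
    refine ⟨a⁻¹, Γ₁.inv_mem ha, fun p hp => ?_⟩
    rw [inv_smul_eq_iff, hxa _ (h₁ _ (Γ₁.inv_mem ha) p hp), smul_inv_smul]

end CircleDiff

namespace CircleDiff

/-! ### The flow of a smooth periodic vector field on the line. -/

/-- A smooth `1`-periodic function on the line: a smooth vector field on the circle. -/
structure SmoothPeriodic (V : ℝ → ℝ) : Prop where
  contDiff : ContDiff ℝ ∞ V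
  periodic : Function.Periodic V 1

namespace SmoothPeriodic

variable {V : ℝ → ℝ}

theorem hasDerivAt (hV : SmoothPeriodic V) (x : ℝ) : HasDerivAt V (deriv V x) x :=
  (hV.contDiff.differentiable (by simp) x).hasDerivAt

theorem exists_bound (hV : SmoothPeriodic V) : ∃ L : NNReal, ∀ x, ‖V x‖ ≤ L := by
  obtain ⟨L, hL⟩ := (hV.periodic.isBounded_of_continuous one_ne_zero
    hV.contDiff.continuous).exists_norm_le
  exact ⟨L.toNNReal, fun x => (hL _ ⟨x, rfl⟩).trans (Real.le_coe_toNNReal L)⟩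

theorem contDiff_deriv (hV : SmoothPeriodic V) : ContDiff ℝ ∞ (deriv V) :=
  (contDiff_infty_iff_deriv.1 hV.contDiff).2

theorem periodic_deriv (hV : SmoothPeriodic V) : Function.Periodic (deriv V) 1 := fun x => by
  have : (fun y => V (y + 1)) = V := funext hV.periodic
  rw [← deriv_comp_add_const, this]

theorem deriv' (hV : SmoothPeriodic V) : SmoothPeriodic (deriv V) :=
  ⟨hV.contDiff_deriv, hV.periodic_deriv⟩

theorem exists_lipschitz (hV : SmoothPeriodic V) : ∃ K : NNReal, LipschitzWith K V := by
  obtain ⟨K, hK⟩ := hV.deriv'.exists_bound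
  exact ⟨K, lipschitzWith_of_nnnorm_deriv_le (hV.contDiff.differentiable (by simp)) fun x => hK x⟩

theorem solution_unique (hV : SmoothPeriodic V) {c d : ℝ → ℝ}
    (hc : ∀ s, HasDerivAt c (V (c s)) s) (hd : ∀ s, HasDerivAt d (V (d s)) s) {t₀ : ℝ}
    (h : c t₀ = d t₀) : c = d := by
  obtain ⟨K, hK⟩ := hV.exists_lipschitz
  exact ODE_solution_unique_univ (v := fun _ => V) (s := fun _ => Set.univ) (t₀ := t₀)
    (fun _ => hK.lipschitzOnWith) (fun t => ⟨hc t, trivial⟩) (fun t => ⟨hd t, trivial⟩) h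

/-- Because V is bounded by L on the whole line, Picard–Lindelöf applies on a ball of radius L * T,
for any T. -/
theorem exists_solution_Ioo (hV : SmoothPeriodic V) (x : ℝ) {T : ℝ} (hT : 0 < T) :
    ∃ c : ℝ → ℝ, c 0 = x ∧ ∀ s ∈ Set.Ioo (-T) T, HasDerivAt c (V (c s)) s := by
  obtain ⟨K, hK⟩ := hV.exists_lipschitz
  obtain ⟨L, hL⟩ := hV.exists_bound
  have h0 : (0 : ℝ) ∈ Set.Icc (-T) T := ⟨by linarith, hT.le⟩
  have hPL : IsPicardLindelof (fun _ => V) (⟨0, h0⟩ : Set.Icc (-T) T) x (L * T.toNNReal) 0 L K :=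
    IsPicardLindelof.of_time_independent (fun y _ => hL y) hK.lipschitzOnWith (by
      simp [hT.le])
  obtain ⟨c, hc0, hc⟩ := hPL.exists_eq_forall_mem_Icc_hasDerivWithinAt₀
  exact ⟨c, hc0, fun s hs =>
    (hc s (Set.Ioo_subset_Icc_self hs)).hasDerivAt (Icc_mem_nhds hs.1 hs.2)⟩

theorem exists_solution (hV : SmoothPeriodic V) (x : ℝ) :
    ∃ c : ℝ → ℝ, c 0 = x ∧ ∀ s, HasDerivAt c (V (c s)) s := by
  obtain ⟨K, hK⟩ := hV.exists_lipschitz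
  have hpos : ∀ n : ℕ, (0 : ℝ) < n + 1 := fun n => by positivity
  choose c hc0 hc using fun n : ℕ => hV.exists_solution_Ioo x (hpos n)
  have hag : ∀ m n : ℕ, m ≤ n → Set.EqOn (c m) (c n) (Set.Ioo (-(m + 1 : ℝ)) (m + 1)) :=
    fun m n hmn => by
      have hmn' : (m : ℝ) ≤ n := by exact_mod_cast hmn
      refine ODE_solution_unique_of_mem_Ioo (v := fun _ => V) (s := fun _ => Set.univ) (t₀ := 0)
        (fun _ _ => hK.lipschitzOnWith) ⟨by linarith [hpos m], hpos m⟩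
        (fun t ht => ⟨hc m t ht, trivial⟩)
        (fun t ht => ⟨hc n t ⟨by linarith [ht.1], by linarith [ht.2]⟩, trivial⟩) ?_
      rw [hc0, hc0]
  have hag' : ∀ (m n : ℕ) (s : ℝ), |s| < m + 1 → |s| < n + 1 → c m s = c n s := fun m n s hm hn => by
    rcases le_total m n with h | h
    · exact hag m n h (abs_lt.1 hm)
    · exact (hag n m h (abs_lt.1 hn)).symm
  -- The index jumps at integers, so differentiability at s is checked against the single solution
  -- of index ⌈|s|⌉₊ + 1, which agrees with the glued one near s.
  refine ⟨fun s => c ⌈|s|⌉₊ s, hc0 _, fun s => ?_⟩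
  have hs : |s| < (⌈|s|⌉₊ + 1 : ℕ) + 1 := by
    have := Nat.le_ceil |s|
    push_cast; linarith
  have := hc (⌈|s|⌉₊ + 1) s (abs_lt.1 hs)
  have heq : (fun r => c ⌈|r|⌉₊ r) =ᶠ[nhds s] c (⌈|s|⌉₊ + 1) := by
    filter_upwards [(continuous_abs.tendsto s).eventually (gt_mem_nhds hs)] with r hr
    refine hag' _ _ _ ?_ hr
    have := Nat.le_ceil |r|
    linarith
  have hval : c ⌈|s|⌉₊ s = c (⌈|s|⌉₊ + 1) s := heq.eq_of_nhds
  exact (this.congr_of_eventuallyEq heq).congr_deriv (congrArg V hval.symm)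

/-- The flow of a smooth periodic vector field on the line. -/
noncomputable def flow (hV : SmoothPeriodic V) (t x : ℝ) : ℝ := (hV.exists_solution x).choose t

@[simp] theorem flow_zero (hV : SmoothPeriodic V) (x : ℝ) : hV.flow 0 x = x :=
  (hV.exists_solution x).choose_spec.1

theorem hasDerivAt_flow (hV : SmoothPeriodic V) (t x : ℝ) :
    HasDerivAt (fun s => hV.flow s x) (V (hV.flow t x)) t :=
  (hV.exists_solution x).choose_spec.2 t

theorem continuous_flow_time (hV : SmoothPeriodic V) (x : ℝ) :
    Continuous fun s => hV.flow s x :=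
  continuous_iff_continuousAt.2 fun t => (hV.hasDerivAt_flow t x).continuousAt

theorem eq_flow (hV : SmoothPeriodic V) {c : ℝ → ℝ} (hc : ∀ s, HasDerivAt c (V (c s)) s) (t : ℝ) :
    c t = hV.flow t (c 0) :=
  congrFun (hV.solution_unique hc (fun s => hV.hasDerivAt_flow s (c 0)) (t₀ := 0) (by simp)) t

theorem flow_add (hV : SmoothPeriodic V) (s t x : ℝ) :
    hV.flow (s + t) x = hV.flow s (hV.flow t x) := by
  have := hV.eq_flow (c := fun r => hV.flow (r + t) x)
    (fun r => (hV.hasDerivAt_flow (r + t) x).comp_add_const r t) s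
  simpa using this

theorem flow_add_one (hV : SmoothPeriodic V) (t x : ℝ) : hV.flow t (x + 1) = hV.flow t x + 1 := by
  have := hV.eq_flow (c := fun r => hV.flow r x + 1)
    (fun r => by rw [hV.periodic]; exact (hV.hasDerivAt_flow r x).add_const 1) t
  simpa using this.symm

theorem flow_eq_self (hV : SmoothPeriodic V) {x : ℝ} (hx : V x = 0) (t : ℝ) : hV.flow t x = x :=
  (hV.eq_flow (c := fun _ => x) (fun s => by rw [hx]; exact hasDerivAt_const s x) t).symm

theorem flow_injective (hV : SmoothPeriodic V) (t : ℝ) : Function.Injective (hV.flow t) :=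
  Function.LeftInverse.injective (g := hV.flow (-t)) fun x => by rw [← flow_add]; simp

/-- The slope of `V` between two trajectories. -/
noncomputable def flowSlope (hV : SmoothPeriodic V) (x y s : ℝ) : ℝ :=
  (V (hV.flow s y) - V (hV.flow s x)) / (hV.flow s y - hV.flow s x)

theorem continuous_flowSlope (hV : SmoothPeriodic V) {x y : ℝ} (h : x ≠ y) :
    Continuous (hV.flowSlope x y) :=
  ((hV.contDiff.continuous.comp (hV.continuous_flow_time y)).sub
    (hV.contDiff.continuous.comp (hV.continuous_flow_time x))).div
    ((hV.continuous_flow_time y).sub (hV.continuous_flow_time x))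
    fun s => sub_ne_zero.2 fun h' => h (hV.flow_injective s h').symm

/-- The difference w of two trajectories solves the linear equation w' = q w, with q the slope of V
between them. The formula yields the monotonicity of the flow in x and, letting y tend to x, its
derivative. -/
theorem flow_sub_flow (hV : SmoothPeriodic V) {x y : ℝ} (h : x ≠ y) (t : ℝ) :
    hV.flow t y - hV.flow t x = (y - x) * Real.exp (∫ s in (0 : ℝ)..t, hV.flowSlope x y s) := by
  have hq := hV.continuous_flowSlope h
  let g : ℝ → ℝ := fun t => (hV.flow t y - hV.flow t x) *
    Real.exp (-∫ s in (0 : ℝ)..t, hV.flowSlope x y s)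
  have hg : ∀ t, HasDerivAt g 0 t := fun t => by
    have h1 : HasDerivAt (fun t => ∫ s in (0 : ℝ)..t, hV.flowSlope x y s) (hV.flowSlope x y t) t :=
      hq.integral_hasStrictDerivAt 0 t |>.hasDerivAt
    have h2 := ((hV.hasDerivAt_flow t y).sub (hV.hasDerivAt_flow t x)).mul h1.neg.exp
    refine h2.congr_deriv ?_
    have hne : hV.flow t y - hV.flow t x ≠ 0 :=
      sub_ne_zero.2 fun h' => h (hV.flow_injective t h').symm
    simp only [flowSlope, Pi.sub_apply]
    field_simp
    ring
  have hconst : g t = g 0 :=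
    is_const_of_deriv_eq_zero (fun s => (hg s).differentiableAt) (fun s => (hg s).deriv) t 0
  have h0 : g 0 = y - x := by simp [g]
  rw [← h0, ← hconst]
  simp only [g]
  rw [mul_assoc, ← Real.exp_add]
  simp

theorem strictMono_flow (hV : SmoothPeriodic V) (t : ℝ) : StrictMono (hV.flow t) := fun x y h => by
  rw [← sub_pos, hV.flow_sub_flow h.ne]
  exact mul_pos (sub_pos.2 h) (Real.exp_pos _)

theorem norm_flowSlope_le {K : NNReal} (hV : SmoothPeriodic V) (hK : LipschitzWith K V)
    (x y s : ℝ) : ‖hV.flowSlope x y s‖ ≤ K := by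
  rw [flowSlope, norm_div]
  refine div_le_of_le_mul₀ (norm_nonneg _) K.2 ?_
  have := hK.dist_le_mul (hV.flow s y) (hV.flow s x)
  rwa [dist_eq_norm, dist_eq_norm] at this

theorem continuous_flow_space (hV : SmoothPeriodic V) (t : ℝ) : Continuous (hV.flow t) :=
  (hV.strictMono_flow t).monotone.continuous_of_surjective fun y =>
    ⟨hV.flow (-t) y, by rw [← flow_add]; simp⟩

theorem continuous_flow (hV : SmoothPeriodic V) : Continuous (Function.uncurry hV.flow) := by
  obtain ⟨L, hL⟩ := hV.exists_bound
  refine continuous_prod_of_continuous_lipschitzWith _ L (fun t => hV.continuous_flow_space t)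
    fun x => ?_
  refine lipschitzWith_of_nnnorm_deriv_le (fun t => (hV.hasDerivAt_flow t x).differentiableAt)
    fun t => ?_
  change ‖deriv (fun s => hV.flow s x) t‖ ≤ L
  rw [(hV.hasDerivAt_flow t x).deriv]
  exact hL _

/-- This is the limit of `flow_sub_flow` as y tends to x: the slopes tend to the derivative of V and
are dominated by its Lipschitz constant. -/
theorem hasDerivAt_flow_space (hV : SmoothPeriodic V) (t x : ℝ) :
    HasDerivAt (hV.flow t) (Real.exp (∫ s in (0 : ℝ)..t, deriv V (hV.flow s x))) x := by
  obtain ⟨K, hK⟩ := hV.exists_lipschitz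
  rw [hasDerivAt_iff_tendsto_slope]
  have h1 : Filter.Tendsto (fun y => ∫ s in (0 : ℝ)..t, hV.flowSlope x y s)
      (nhdsWithin x {x}ᶜ) (nhds (∫ s in (0 : ℝ)..t, deriv V (hV.flow s x))) := by
    refine intervalIntegral.tendsto_integral_filter_of_dominated_convergence (fun _ => (K : ℝ))
      ?_ ?_ (by simp) ?_
    · filter_upwards [self_mem_nhdsWithin] with y hy
      exact (hV.continuous_flowSlope (Ne.symm hy)).aestronglyMeasurable
    · exact Filter.Eventually.of_forall fun y =>
        Filter.Eventually.of_forall fun s _ => hV.norm_flowSlope_le hK x y s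
    · refine Filter.Eventually.of_forall fun s _ => ?_
      have h2 := hasDerivAt_iff_tendsto_slope.1 (hV.hasDerivAt (hV.flow s x))
      have h3 : Filter.Tendsto (hV.flow s) (nhdsWithin x {x}ᶜ)
          (nhdsWithin (hV.flow s x) {hV.flow s x}ᶜ) :=
        tendsto_nhdsWithin_iff.2 ⟨((hV.continuous_flow_space s).tendsto x).mono_left
          nhdsWithin_le_nhds, by
            filter_upwards [self_mem_nhdsWithin] with y hy
            exact fun h => hy (hV.flow_injective s h)⟩
      refine (h2.comp h3).congr fun y => ?_
      simp only [Function.comp, slope_def_field, flowSlope]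
  refine ((Real.continuous_exp.tendsto _).comp h1).congr' ?_
  filter_upwards [self_mem_nhdsWithin] with y hy
  rw [slope_def_field, hV.flow_sub_flow (Ne.symm hy), mul_div_cancel_left₀]
  · rfl
  · exact sub_ne_zero.2 hy

end SmoothPeriodic

/-! ### Smooth dependence of the flow on the initial point. -/

/-- `h t x` is jointly continuous together with its first `n` derivatives in `x`. -/
def SmoothInSpace : ℕ → (ℝ → ℝ → ℝ) → Prop
  | 0, h => Continuous (Function.uncurry h)
  | n + 1, h => Continuous (Function.uncurry h) ∧
      ∃ h' : ℝ → ℝ → ℝ, (∀ t x, HasDerivAt (h t) (h' t x) x) ∧ SmoothInSpace n h'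

namespace SmoothInSpace

variable {n : ℕ} {g h : ℝ → ℝ → ℝ}

theorem continuous (hh : SmoothInSpace n h) : Continuous (Function.uncurry h) := by
  cases n with
  | zero => exact hh
  | succ n => exact hh.1

theorem of_succ (hh : SmoothInSpace (n + 1) h) : SmoothInSpace n h := by
  induction n generalizing h with
  | zero => exact hh.1
  | succ n ih =>
    obtain ⟨h1, h', h2, h3⟩ := hh
    exact ⟨h1, h', h2, ih h3⟩

theorem add (hg : SmoothInSpace n g) (hh : SmoothInSpace n h) :
    SmoothInSpace n (fun t x => g t x + h t x) := by
  induction n generalizing g h with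
  | zero => exact Continuous.add hg hh
  | succ n ih =>
    obtain ⟨g1, g', g2, g3⟩ := hg
    obtain ⟨h1, h', h2, h3⟩ := hh
    exact ⟨g1.add h1, _, fun t x => (g2 t x).add (h2 t x), ih g3 h3⟩

theorem mul (hg : SmoothInSpace n g) (hh : SmoothInSpace n h) :
    SmoothInSpace n (fun t x => g t x * h t x) := by
  induction n generalizing g h with
  | zero => exact Continuous.mul hg hh
  | succ n ih =>
    have hg0 := hg.of_succ
    have hh0 := hh.of_succ
    obtain ⟨g1, g', g2, g3⟩ := hg
    obtain ⟨h1, h', h2, h3⟩ := hh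
    exact ⟨g1.mul h1, _, fun t x => (g2 t x).mul (h2 t x), (ih g3 hh0).add (ih hg0 h3)⟩

theorem comp {F : ℝ → ℝ} (hF : ContDiff ℝ ∞ F) (hh : SmoothInSpace n h) :
    SmoothInSpace n (fun t x => F (h t x)) := by
  induction n generalizing F h with
  | zero => exact hF.continuous.comp hh
  | succ n ih =>
    have hh0 := hh.of_succ
    obtain ⟨h1, h', h2, h3⟩ := hh
    exact ⟨hF.continuous.comp h1, _, fun t x =>
      ((hF.differentiable (by simp) (h t x)).hasDerivAt).comp x (h2 t x),
      (ih (contDiff_infty_iff_deriv.1 hF).2 hh0).mul h3⟩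

theorem hasDerivAt_integral {g' : ℝ → ℝ → ℝ} (hg : Continuous (Function.uncurry g))
    (hg' : Continuous (Function.uncurry g')) (hd : ∀ t x, HasDerivAt (g t) (g' t x) x) (t x : ℝ) :
    HasDerivAt (fun x => ∫ s in (0 : ℝ)..t, g s x) (∫ s in (0 : ℝ)..t, g' s x) x := by
  have hK : IsCompact (Set.uIcc 0 t ×ˢ Metric.closedBall x 1) :=
    isCompact_uIcc.prod (isCompact_closedBall x 1)
  obtain ⟨M, hM⟩ := hK.exists_bound_of_continuousOn hg'.continuousOn
  have c1 : ∀ y, Continuous fun s => g s y :=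
    fun y => hg.comp (by fun_prop : Continuous fun s => (s, y))
  have c2 : ∀ y, Continuous fun s => g' s y :=
    fun y => hg'.comp (by fun_prop : Continuous fun s => (s, y))
  refine (intervalIntegral.hasDerivAt_integral_of_dominated_loc_of_deriv_le
    (F := fun x s => g s x) (F' := fun x s => g' s x) (bound := fun _ => M)
    (Metric.closedBall_mem_nhds x one_pos) ?_ ((c1 x).intervalIntegrable _ _)
    (c2 x).aestronglyMeasurable ?_ (by simp) ?_).2
  · exact Filter.Eventually.of_forall fun y => (c1 y).aestronglyMeasurable
  · exact Filter.Eventually.of_forall fun s hs y hy => hM (s, y) ⟨Set.uIoc_subset_uIcc hs, hy⟩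
  · exact Filter.Eventually.of_forall fun s _ y _ => hd s y

theorem integral (hg : SmoothInSpace n g) :
    SmoothInSpace n (fun t x => ∫ s in (0 : ℝ)..t, g s x) := by
  have hcont : ∀ {g : ℝ → ℝ → ℝ}, Continuous (Function.uncurry g) →
      Continuous (Function.uncurry fun t x => ∫ s in (0 : ℝ)..t, g s x) := fun {g} hg => by
    refine intervalIntegral.continuous_parametric_intervalIntegral_of_continuous
      (f := fun (p : ℝ × ℝ) s => g s p.2) (s := Prod.fst) ?_ continuous_fst
    exact hg.comp (by fun_prop : Continuous fun q : (ℝ × ℝ) × ℝ => (q.2, q.1.2))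
  induction n generalizing g with
  | zero => exact hcont hg
  | succ n ih =>
    obtain ⟨g1, g', g2, g3⟩ := hg
    exact ⟨hcont g1, _, fun t x => hasDerivAt_integral g1 g3.continuous g2 t x, ih g3⟩

theorem contDiff (hh : SmoothInSpace n h) (t : ℝ) : ContDiff ℝ n (h t) := by
  induction n generalizing h with
  | zero =>
    exact contDiff_zero.2 (hh.continuous.comp (by fun_prop : Continuous fun x : ℝ => (t, x)))
  | succ n ih =>
    obtain ⟨h1, h', h2, h3⟩ := hh
    have hd : deriv (h t) = h' t := funext fun x => (h2 t x).deriv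
    rw [Nat.cast_succ, contDiff_succ_iff_deriv]
    exact ⟨fun x => (h2 t x).differentiableAt, by simp, by rw [hd]; exact ih h3⟩

theorem continuous_iteratedDeriv (hh : SmoothInSpace n h) :
    Continuous (Function.uncurry fun t x => iteratedDeriv n (h t) x) := by
  induction n generalizing h with
  | zero => simpa using hh.continuous
  | succ n ih =>
    obtain ⟨h1, h', h2, h3⟩ := hh
    have hd : ∀ t, deriv (h t) = h' t := fun t => funext fun x => (h2 t x).deriv
    simpa only [iteratedDeriv_succ', hd] using ih h3

end SmoothInSpace

namespace SmoothPeriodic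

variable {V : ℝ → ℝ}

/-- A bootstrap: the space derivative of the flow is the exponential of an integral of V' along the
flow, so it is as regular as the flow is already known to be. -/
theorem smoothInSpace_flow (hV : SmoothPeriodic V) (n : ℕ) : SmoothInSpace n hV.flow := by
  induction n with
  | zero => exact hV.continuous_flow
  | succ n ih =>
    exact ⟨hV.continuous_flow, _, hV.hasDerivAt_flow_space,
      (ih.comp hV.contDiff_deriv).integral.comp Real.contDiff_exp⟩

theorem contDiff_flow (hV : SmoothPeriodic V) (t : ℝ) : ContDiff ℝ ∞ (hV.flow t) :=
  contDiff_infty.2 fun n => (hV.smoothInSpace_flow n).contDiff t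

theorem continuous_iteratedDeriv_flow (hV : SmoothPeriodic V) (n : ℕ) :
    Continuous (Function.uncurry fun t x => iteratedDeriv n (hV.flow t) x) :=
  (hV.smoothInSpace_flow n).continuous_iteratedDeriv

/-- The time `t` map of the flow as a degree one lift. -/
noncomputable def flowLift (hV : SmoothPeriodic V) (t : ℝ) : CircleDeg1Liftˣ where
  val := ⟨⟨hV.flow t, (hV.strictMono_flow t).monotone⟩, hV.flow_add_one t⟩
  inv := ⟨⟨hV.flow (-t), (hV.strictMono_flow (-t)).monotone⟩, hV.flow_add_one (-t)⟩
  val_inv := CircleDeg1Lift.ext fun x => by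
    change hV.flow t (hV.flow (-t) x) = x
    rw [← flow_add]; simp
  inv_val := CircleDeg1Lift.ext fun x => by
    change hV.flow (-t) (hV.flow t x) = x
    rw [← flow_add]; simp

/-- The time `t` map of the flow as a circle diffeomorphism. -/
noncomputable def flowDiff (hV : SmoothPeriodic V) (t : ℝ) : DiffPlus :=
  diffOfLift (hV.flowLift t) (hV.contDiff_flow t) (hV.contDiff_flow (-t))

theorem flowDiff_smul (hV : SmoothPeriodic V) (t x : ℝ) :
    hV.flowDiff t • (x : S1) = ((hV.flow t x : ℝ) : S1) := circleMap_coe _ x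

theorem isLift_flowLift (hV : SmoothPeriodic V) (t : ℝ) :
    IsLift (hV.flowLift t) (hV.flowDiff t : HomeoPlus) := isLift_homeoOfLift _

theorem flowDiff_add (hV : SmoothPeriodic V) (s t : ℝ) :
    hV.flowDiff (s + t) = hV.flowDiff s * hV.flowDiff t := diffPlus_ext fun p => by
  obtain ⟨x, rfl⟩ := exists_coe_eq p
  rw [mul_smul, flowDiff_smul, flowDiff_smul, flowDiff_smul, flow_add]

theorem flowDiff_zero (hV : SmoothPeriodic V) : hV.flowDiff 0 = 1 := diffPlus_ext fun p => by
  obtain ⟨x, rfl⟩ := exists_coe_eq p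
  rw [flowDiff_smul, flow_zero, one_smul]

end SmoothPeriodic

end CircleDiff

namespace CircleDiff

/-! ### Convergence of the flow to the identity, and nondiscreteness. -/

/-- Joint continuity gives uniformity over the compact interval [0, 1], and periodicity extends it
to the line. -/
theorem tendstoUniformly_of_periodic {Y : Type*} [UniformSpace Y] {D : ℝ → ℝ → Y}
    (hD : Continuous (Function.uncurry D)) (hper : ∀ t, Function.Periodic (D t) 1) (t₀ : ℝ) :
    TendstoUniformly D (D t₀) (nhds t₀) := by
  have h := Continuous.tendstoUniformly (fun (t : ℝ) (x : Set.Icc (0 : ℝ) 1) => D t x)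
    (hD.comp (by fun_prop : Continuous fun q : ℝ × Set.Icc (0 : ℝ) 1 => (q.1, (q.2 : ℝ)))) t₀
  intro u hu
  filter_upwards [h u hu] with t ht x
  have hfr : Int.fract x ∈ Set.Icc (0 : ℝ) 1 := ⟨Int.fract_nonneg x, (Int.fract_lt_one x).le⟩
  have hx : ∀ s, D s (Int.fract x) = D s x := fun s => by
    have := (hper s).sub_int_mul_eq (x := x) ⌊x⌋
    rwa [mul_one] at this
  have := ht ⟨_, hfr⟩
  simpa only [hx] using this

/-- Derivatives of positive order do not see the integer translation between two lifts, so
`crTopology` may be tested on any lift. -/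
theorem iteratedDeriv_lift_eq {F : CircleDeg1Liftˣ} {f : HomeoPlus} (hF : IsLift F f) {k : ℕ}
    (hk : 1 ≤ k) : iteratedDeriv k (lift f : ℝ → ℝ) = iteratedDeriv k (F : ℝ → ℝ) := by
  obtain ⟨n, hn⟩ := (isLift_lift f).exists_int hF
  obtain ⟨m, rfl⟩ := Nat.exists_eq_add_of_le' hk
  rw [iteratedDeriv_succ', iteratedDeriv_succ']
  congr 1
  have : (lift f : ℝ → ℝ) = fun x => F x + (n : ℝ) := funext hn
  rw [this]
  exact funext fun x => deriv_add_const _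

namespace SmoothPeriodic

variable {V : ℝ → ℝ}

theorem periodic_iteratedDeriv_flow (hV : SmoothPeriodic V) {k : ℕ} (hk : 1 ≤ k) (t : ℝ) :
    Function.Periodic (iteratedDeriv k (hV.flow t)) 1 := fun x => by
  have h1 : iteratedDeriv k (fun y => hV.flow t (y + 1)) x =
      iteratedDeriv k (hV.flow t) (x + 1) := by rw [iteratedDeriv_comp_add_const]
  rw [← h1]
  obtain ⟨m, rfl⟩ := Nat.exists_eq_add_of_le' hk
  rw [iteratedDeriv_succ', iteratedDeriv_succ']
  congr 1
  have : (fun y => hV.flow t (y + 1)) = fun y => hV.flow t y + 1 := funext (hV.flow_add_one t)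
  rw [this]
  exact funext fun x => deriv_add_const _

/-- The flow of a smooth vector field tends to the identity in every `C^r`-topology. -/
theorem tendsto_flowDiff (hV : SmoothPeriodic V) (r : ℕ∞) :
    Filter.Tendsto hV.flowDiff (nhds 0) (@nhds DiffPlus (crTopology r) 1) := by
  rw [crTopology, nhds_inf, nhds_iInf, Filter.tendsto_inf]
  constructor
  · rw [nhds_induced, Filter.tendsto_comap_iff, UniformFun.tendsto_iff_tendstoUniformly]
    have h := tendstoUniformly_of_periodic (D := fun t x => ((hV.flow t x : ℝ) : S1))
      (continuous_coe_S1.comp hV.continuous_flow) (fun t x => by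
        simp only [hV.flow_add_one]
        exact coe_eq_coe_iff.2 ⟨1, by simp⟩) 0
    -- Uniform convergence over the line passes to the circle through a set-theoretic section of the
    -- projection.
    have hs := Function.surjInv_eq exists_coe_eq
    have h' := h.comp (Function.surjInv exists_coe_eq)
    convert h' using 1
    · funext t p
      conv_lhs => rw [← hs p]
      exact hV.flowDiff_smul t _
    · funext p
      simp only [Function.comp, flow_zero, hs]
      exact one_smul DiffPlus p
  · rw [Filter.tendsto_iInf]
    intro k
    rw [nhds_iInf, Filter.tendsto_iInf]
    intro hk
    rw [nhds_iInf, Filter.tendsto_iInf]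
    intro _
    rw [nhds_induced, Filter.tendsto_comap_iff, UniformFun.tendsto_iff_tendstoUniformly]
    have h := tendstoUniformly_of_periodic (hV.continuous_iteratedDeriv_flow k)
      (hV.periodic_iteratedDeriv_flow hk) 0
    have e : ∀ t, iteratedDeriv k (lift (hV.flowDiff t : HomeoPlus) : ℝ → ℝ) =
        iteratedDeriv k (hV.flow t) := fun t => iteratedDeriv_lift_eq (hV.isLift_flowLift t) hk
    convert h using 1
    · exact funext e
    · rw [← e 0, flowDiff_zero]
      rfl

/-- The zero z pins down the lift, so the flow on the line itself, and not only modulo integers,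
returns x to x at time t. If t ≠ 0, Rolle's theorem gives an instant of zero speed, yet a trajectory
that meets a zero of V is constant. -/
theorem eq_zero_of_flowDiff_eq_one (hV : SmoothPeriodic V) {z : ℝ} (hz : V z = 0) {x : ℝ}
    (hx : V x ≠ 0) {t : ℝ} (h : hV.flowDiff t = 1) : t = 0 := by
  have h1 : ((hV.flow t x : ℝ) : S1) = (x : S1) := by rw [← flowDiff_smul, h, one_smul]
  have hfix : hV.flow t x = x := lift_eq_of_agree (C := Set.univ) (F := hV.flowLift t) (G := 1)
    (fun y _ => by
      change ((hV.flow t y : ℝ) : S1) = (y : S1)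
      rw [← flowDiff_smul, h, one_smul])
    (x₀ := z) (hV.flow_eq_self hz t) x trivial
  have hne : ∀ s, V (hV.flow s x) ≠ 0 := fun s hs => by
    have h2 := hV.flow_eq_self hs (-s)
    rw [← flow_add] at h2
    simp only [neg_add_cancel, flow_zero] at h2
    rw [← h2] at hs
    exact hx hs
  have hd : ∀ s, deriv (fun s => hV.flow s x) s ≠ 0 := fun s => by
    rw [(hV.hasDerivAt_flow s x).deriv]; exact hne s
  have hc := hV.continuous_flow_time x
  have hends : hV.flow 0 x = hV.flow t x := by rw [flow_zero, hfix]
  rcases lt_trichotomy t 0 with ht | ht | ht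
  · obtain ⟨s, _, hs⟩ := exists_deriv_eq_zero ht hc.continuousOn hends.symm
    exact absurd hs (hd s)
  · exact ht
  · obtain ⟨s, _, hs⟩ := exists_deriv_eq_zero ht hc.continuousOn hends
    exact absurd hs (hd s)

end SmoothPeriodic

theorem IsSmoothVectorField.smoothPeriodic {X : S1 → ℝ} (hX : IsSmoothVectorField X) :
    SmoothPeriodic fun x : ℝ => X (x : S1) :=
  ⟨hX, fun x => congrArg X (coe_eq_coe_iff.2 ⟨1, by simp⟩)⟩

theorem isFlowMap_iff {X : S1 → ℝ} (hX : IsSmoothVectorField X) {t : ℝ} {f : DiffPlus} :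
    IsFlowMap X t f ↔ f = hX.smoothPeriodic.flowDiff t := by
  constructor
  · intro h
    refine diffPlus_ext fun p => ?_
    obtain ⟨x, rfl⟩ := exists_coe_eq p
    obtain ⟨c, hc0, hc, hf⟩ := h x
    rw [hf, hX.smoothPeriodic.flowDiff_smul, hX.smoothPeriodic.eq_flow hc t, hc0]
  · rintro rfl x
    exact ⟨fun s => hX.smoothPeriodic.flow s x, hX.smoothPeriodic.flow_zero x,
      fun s => hX.smoothPeriodic.hasDerivAt_flow s x, hX.smoothPeriodic.flowDiff_smul t x⟩

/-- A group containing a dense set of times of a nontrivial flow with a zero is not discrete. -/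
theorem not_isCrDiscrete_of_dense {V : ℝ → ℝ} (hV : SmoothPeriodic V) {z : ℝ} (hz : V z = 0)
    {x : ℝ} (hx : V x ≠ 0) {Γ : Subgroup DiffPlus} (hd : Dense {t : ℝ | hV.flowDiff t ∈ Γ})
    (r : ℕ∞) : ¬ IsCrDiscrete r Γ := fun hdis => by
  have h1 : ({1} : Set Γ) ∈ @nhds Γ ((crTopology r).induced fun γ : Γ => (γ : DiffPlus)) 1 :=
    @IsOpen.mem_nhds Γ ((crTopology r).induced fun γ : Γ => (γ : DiffPlus)) _ _
      (@isOpen_discrete Γ ((crTopology r).induced fun γ : Γ => (γ : DiffPlus)) hdis {1}) rfl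
  rw [@nhds_induced, Filter.mem_comap] at h1
  obtain ⟨U, hU, hU1⟩ := h1
  have h2 := hV.tendsto_flowDiff r hU
  obtain ⟨ε, hε, hball⟩ := Metric.mem_nhds_iff.1 h2
  -- A small positive time in the dense set gives an element of Γ close to the identity but
  -- different from it.
  obtain ⟨t, ht, htΓ⟩ := hd.exists_mem_open isOpen_Ioo (⟨ε / 2, by constructor <;> linarith⟩ :
    (Set.Ioo 0 ε).Nonempty)
  have hone : (⟨hV.flowDiff t, ht⟩ : Γ) = 1 := hU1 (hball (by
    rw [Metric.mem_ball, Real.dist_eq, sub_zero, abs_of_pos htΓ.1]; exact htΓ.2) :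
    hV.flowDiff t ∈ U)
  have := hV.eq_zero_of_flowDiff_eq_one hz hx (congrArg Subtype.val hone)
  exact htΓ.1.ne' this

/-! ### Properties of the groups obtained from the construction. -/

namespace IsConstruction

variable {Γ₁ Γ₂ : Subgroup DiffPlus} {C I : Set S1} {X : S1 → ℝ}

theorem vanish_on (h : IsConstruction Γ₁ C I X Γ₂) {p : S1} (hp : p ∈ C) : X p = 0 := by
  obtain ⟨x, _, rfl⟩ := h.component
  exact h.vanish p fun hI => connectedComponentIn_subset _ _ hI hp

theorem not_isCrDiscrete (h : IsConstruction Γ₁ C I X Γ₂) (r : ℕ∞) :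
    ¬ IsCrDiscrete r (Γ₁ ⊔ Γ₂) := by
  obtain ⟨p, hp⟩ := h.exceptional.nonempty
  obtain ⟨z, rfl⟩ := exists_coe_eq p
  obtain ⟨q, hq⟩ := Function.ne_iff.1 h.nontrivial
  obtain ⟨x, rfl⟩ := exists_coe_eq q
  refine not_isCrDiscrete_of_dense h.smooth.smoothPeriodic (h.vanish_on hp) hq
    (h.dense.mono ?_) r
  rintro t ⟨g, hg, hgt⟩
  rw [isFlowMap_iff h.smooth] at hgt
  exact (le_sup_right : Γ₂ ≤ Γ₁ ⊔ Γ₂) (hgt ▸ hg)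

theorem fix (h : IsConstruction Γ₁ C I X Γ₂) {g : DiffPlus} (hg : g ∈ Γ₂) {p : S1} (hp : p ∈ C) :
    g • p = p := by
  obtain ⟨t, ht⟩ := h.flow g hg
  rw [isFlowMap_iff h.smooth] at ht
  obtain ⟨x, rfl⟩ := exists_coe_eq p
  rw [ht, SmoothPeriodic.flowDiff_smul, SmoothPeriodic.flow_eq_self _ (h.vanish_on hp)]

/-- On C each element coincides with some γ in Γ₁ and so has the same rotation number, which is zero
because γ has a fixed point. -/
theorem rotationImage_eq (h : IsConstruction Γ₁ C I X Γ₂) : rotationImage (Γ₁ ⊔ Γ₂) = {0} := by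
  have key : ∀ f ∈ Γ₁ ⊔ Γ₂, rotationNumber (f : HomeoPlus) = 0 := fun f hf => by
    obtain ⟨γ, hγ, hag⟩ := exists_agree_of_mem_sup h.exceptional.invariant
      (fun g hg p hp => h.fix hg hp) hf
    rw [rotationNumber_eq_of_agree h.exceptional.nonempty (h.exceptional.invariant γ hγ) hag]
    obtain ⟨p, hp⟩ := exists_fixed_of_isFuchsian h.fuchsian h.torsionFree hγ
    exact rotationNumber_eq_zero_of_fixed hp
  refine Set.Subset.antisymm ?_ ?_
  · rintro _ ⟨f, hf, rfl⟩
    exact key f hf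
  · rintro _ rfl
    exact ⟨1, Subgroup.one_mem _, key 1 (Subgroup.one_mem _)⟩

theorem not_hasFiniteOrbit (h : IsConstruction Γ₁ C I X Γ₂) : ¬ HasFiniteOrbit (Γ₁ ⊔ Γ₂) :=
  fun hf => h.exceptional.not_hasFiniteOrbit (hf.mono le_sup_left)

theorem fg_sup (h : IsConstruction Γ₁ C I X Γ₂) : (Γ₁ ⊔ Γ₂).FG := by
  obtain ⟨e⟩ := h.zSquared
  have : AddGroup.FG (ℤ × ℤ) := AddGroup.fg_iff_addMonoid_fg.2 inferInstance
  have : Group.FG Γ₂ := Group.fg_of_surjective (f := e.symm.toMonoidHom) e.symm.surjective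
  exact h.fg.sup ((Group.fg_iff_subgroup_fg _).1 this)

end IsConstruction

section ZSquared

variable {Γ : Subgroup DiffPlus}

theorem infinite_of_zSquared (e : Γ ≃* Multiplicative (ℤ × ℤ)) : ¬ Finite Γ := fun h => by
  have : Finite (Multiplicative (ℤ × ℤ)) := Finite.of_equiv _ e.toEquiv
  have : Finite (ℤ × ℤ) := this
  exact not_finite (ℤ × ℤ)

/-- Finite index would put a positive multiple of each vector of ℤ ⊕ ℤ on the line spanned by w,
which cannot hold for both basis vectors. -/
theorem not_containsInfiniteCyclicFiniteIndex_of_zSquared (e : Γ ≃* Multiplicative (ℤ × ℤ)) :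
    ¬ ContainsInfiniteCyclicFiniteIndex Γ := by
  rintro ⟨c, hc, _, hidx⟩
  set w : ℤ × ℤ := (e ⟨c, hc⟩).toAdd
  have key : ∀ v : ℤ × ℤ, ∃ n : ℕ, 0 < n ∧ ∃ k : ℤ, n • v = k • w := fun v => by
    obtain ⟨n, hn, _, hmem⟩ := Subgroup.exists_pow_mem_of_relIndex_ne_zero hidx
      (e.symm (Multiplicative.ofAdd v)).2
    obtain ⟨k, hk⟩ := Subgroup.mem_zpowers_iff.1 hmem.1
    refine ⟨n, hn, k, ?_⟩
    have h1 : (⟨c, hc⟩ : Γ) ^ k = e.symm (Multiplicative.ofAdd v) ^ n := Subtype.ext hk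
    have h2 := congrArg e h1
    rw [map_zpow, map_pow, MulEquiv.apply_symm_apply] at h2
    exact (congrArg Multiplicative.toAdd h2).symm
  obtain ⟨n, hn, k, hk⟩ := key (1, 0)
  obtain ⟨m, hm, l, hl⟩ := key (0, 1)
  have a1 := congrArg Prod.fst hk
  have a2 := congrArg Prod.snd hk
  have b1 := congrArg Prod.fst hl
  have b2 := congrArg Prod.snd hl
  simp only [Prod.smul_fst, Prod.smul_snd, smul_eq_mul, nsmul_eq_mul] at a1 a2 b1 b2
  have hk0 : k ≠ 0 := by rintro rfl; simp at a1; omega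
  have hw2 : w.2 = 0 := (mul_eq_zero.1 a2.symm).resolve_left hk0
  rw [hw2] at b2
  simp at b2
  omega

theorem not_containsNonabelianFree_of_zSquared (e : Γ ≃* Multiplicative (ℤ × ℤ)) :
    ¬ ContainsNonabelianFree Γ := by
  rintro ⟨H, hH, _, a, ha, b, hb, hab⟩
  have h : (⟨a, hH ha⟩ : Γ) * ⟨b, hH hb⟩ = ⟨b, hH hb⟩ * ⟨a, hH ha⟩ :=
    e.injective (by rw [map_mul, map_mul, mul_comm])
  exact hab (congrArg Subtype.val h)

end ZSquared

/-- The properties of the groups obtained from the construction, and the failure of the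
alternatives known for analytic diffeomorphisms. -/
theorem main_of_exists
    (hex : ∃ (Γ₁ : Subgroup DiffPlus) (C I : Set S1) (X : S1 → ℝ) (Γ₂ : Subgroup DiffPlus),
      IsConstruction Γ₁ C I X Γ₂) :
    (∀ (Γ₁ : Subgroup DiffPlus) (C I : Set S1) (X : S1 → ℝ) (Γ₂ : Subgroup DiffPlus),
      IsConstruction Γ₁ C I X Γ₂ →
        (Γ₁ ⊔ Γ₂).FG ∧
        ¬ IsCrDiscrete ⊤ (Γ₁ ⊔ Γ₂) ∧
        ContainsZSquared (Γ₁ ⊔ Γ₂) ∧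
        rotationImage (Γ₁ ⊔ Γ₂) = {0} ∧
        ¬ HasFiniteOrbit (Γ₁ ⊔ Γ₂)) ∧
    (¬ ∀ Γ : Subgroup DiffPlus, ¬ IsCrDiscrete 1 Γ →
        ((rotationImage Γ).Finite ↔ HasFiniteOrbit Γ)) ∧
    (¬ ∀ Γ : Subgroup DiffPlus, ¬ HasFiniteOrbit Γ → (rotationImage Γ).Finite →
        IsCrDiscrete 1 Γ) ∧
    (¬ ∀ Γ : Subgroup DiffPlus, ¬ HasFiniteOrbit Γ → (rotationImage Γ).Finite →
        ∀ Γ' : Subgroup DiffPlus, Γ' ≤ Γ →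
          (Finite Γ' ∨ ContainsInfiniteCyclicFiniteIndex Γ' ∨ ContainsNonabelianFree Γ')) := by
  refine ⟨fun Γ₁ C I X Γ₂ h => ⟨h.fg_sup, h.not_isCrDiscrete ⊤, ⟨Γ₂, le_sup_right, h.zSquared⟩,
    h.rotationImage_eq, h.not_hasFiniteOrbit⟩, ?_⟩
  obtain ⟨Γ₁, C, I, X, Γ₂, h⟩ := hex
  have hfin : (rotationImage (Γ₁ ⊔ Γ₂)).Finite := by
    rw [h.rotationImage_eq]; exact Set.finite_singleton 0
  refine ⟨fun H => h.not_hasFiniteOrbit ((H _ (h.not_isCrDiscrete 1)).1 hfin),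
    fun H => h.not_isCrDiscrete 1 (H _ h.not_hasFiniteOrbit hfin), fun H => ?_⟩
  obtain ⟨e⟩ := h.zSquared
  rcases H _ h.not_hasFiniteOrbit hfin Γ₂ le_sup_right with h1 | h1 | h1
  · exact infinite_of_zSquared e h1
  · exact not_containsInfiniteCyclicFiniteIndex_of_zSquared e h1
  · exact not_containsNonabelianFree_of_zSquared e h1

end CircleDiff

namespace CircleDiff

/-! ### Projective maps as smooth circle diffeomorphisms. -/

theorem exists_int_of_coe_eq {f g : ℝ → ℝ} (hf : Continuous f) (hg : Continuous g)
    (h : ∀ x, (f x : S1) = (g x : S1)) : ∃ n : ℤ, ∀ x, f x = g x + n := by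
  choose n hn using fun x => coe_eq_coe_iff.1 (h x)
  have hc : Continuous n := by
    rw [Int.isClosedEmbedding_coe_real.isEmbedding.continuous_iff]
    have : ((fun m : ℤ => (m : ℝ)) ∘ n) = fun x => f x - g x := by
      funext x; simp only [Function.comp, hn x]; ring
    rw [this]
    exact hf.sub hg
  refine ⟨n 0, fun x => ?_⟩
  rw [hn x, PreconnectedSpace.constant inferInstance hc (x := x) (y := 0)]

namespace ProjLift

variable (A : Matrix.SpecialLinearGroup (Fin 2) ℝ)

/-- The complex linear part of a real matrix acting on `ℂ`. -/
noncomputable def linPart : ℂ := ⟨(A 0 0 + A 1 1) / 2, (A 1 0 - A 0 1) / 2⟩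

/-- The conjugate linear part of a real matrix acting on `ℂ`. -/
noncomputable def antiPart : ℂ := ⟨(A 0 0 - A 1 1) / 2, (A 1 0 + A 0 1) / 2⟩

/-- As a real-linear map of ℂ, A is z ↦ αz + βz̄ with α = `linPart A` and β = `antiPart A`, and its
determinant is |α|² - |β|². -/
theorem normSq_linPart : Complex.normSq (linPart A) = Complex.normSq (antiPart A) + 1 := by
  have := det_fin_two_eq_one A
  simp only [Complex.normSq_mk, linPart, antiPart]
  linarith

theorem linPart_ne_zero : linPart A ≠ 0 := fun h => by
  have h1 := normSq_linPart A
  rw [h, map_zero] at h1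
  linarith [Complex.normSq_nonneg (antiPart A)]

/-- The factor by which the action of a matrix on directions differs from a rotation. -/
noncomputable def distortion (x : ℝ) : ℂ :=
  1 + antiPart A / linPart A * Complex.exp (-(2 * Real.pi * x : ℝ) * Complex.I)

/-- Since |β| < |α|, the distortion stays in the open unit disc around 1. The principal logarithm is
smooth there, which makes `angle` a globally defined smooth lift. -/
theorem distortion_mem_slitPlane (x : ℝ) : distortion A x ∈ Complex.slitPlane := by
  refine Complex.mem_slitPlane_of_norm_lt_one ?_
  rw [norm_mul, ← Complex.ofReal_neg, Complex.norm_exp_ofReal_mul_I, mul_one, norm_div,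
    div_lt_one (norm_pos_iff.2 (linPart_ne_zero A)), ← sq_lt_sq₀ (norm_nonneg _) (norm_nonneg _),
    ← Complex.normSq_eq_norm_sq, ← Complex.normSq_eq_norm_sq, normSq_linPart]
  linarith

/-- A lift of the projective action of a matrix. -/
noncomputable def angle (x : ℝ) : ℝ :=
  x + ((linPart A).arg + (Complex.log (distortion A x)).im) / Real.pi

theorem angle_add_one (x : ℝ) : angle A (x + 1) = angle A x + 1 := by
  have : distortion A (x + 1) = distortion A x := by
    rw [distortion, distortion]
    congr 2
    have : (-(2 * Real.pi * (x + 1) : ℝ) * Complex.I : ℂ) =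
        -(2 * Real.pi * x : ℝ) * Complex.I - 2 * Real.pi * Complex.I := by push_cast; ring
    rw [this, Complex.exp_periodic.sub_eq]
  rw [angle, angle, this]
  ring

theorem contDiff_angle : ContDiff ℝ ∞ (angle A) := by
  have h1 : ContDiff ℝ ∞ (distortion A) := by
    refine contDiff_const.add (contDiff_const.mul ?_)
    refine ContDiff.cexp (ContDiff.mul (ContDiff.neg ?_) contDiff_const)
    exact Complex.ofRealCLM.contDiff.comp (contDiff_const.mul contDiff_id)
  have h2 : ContDiff ℝ ∞ fun x => Complex.log (distortion A x) := by
    rw [contDiff_iff_contDiffAt]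
    intro x
    exact ((Complex.contDiffAt_log (distortion_mem_slitPlane A x)).restrict_scalars ℝ).comp x
      h1.contDiffAt
  exact contDiff_id.add ((contDiff_const.add (Complex.imCLM.contDiff.comp h2)).div_const _)

/-- The image of the unit vector e^{iπx} is αe^{iπx} + βe^{-iπx}, that is, e^{iπx} times α times the
distortion; its argument is π times `angle A x` up to full turns. -/
theorem image_eq (x : ℝ) : (⟨A 0 0 * Real.cos (Real.pi * x) + A 0 1 * Real.sin (Real.pi * x),
      A 1 0 * Real.cos (Real.pi * x) + A 1 1 * Real.sin (Real.pi * x)⟩ : ℂ) =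
    (‖linPart A‖ * ‖distortion A x‖ : ℝ) * Complex.exp ((Real.pi * angle A x : ℝ) * Complex.I) := by
  have e1 : (linPart A : ℂ) = ‖linPart A‖ * Complex.exp ((linPart A).arg * Complex.I) :=
    (Complex.norm_mul_exp_arg_mul_I _).symm
  have e2 : distortion A x = ‖distortion A x‖ *
      Complex.exp ((Complex.log (distortion A x)).im * Complex.I) := by
    rw [Complex.log_im]
    exact (Complex.norm_mul_exp_arg_mul_I _).symm
  have e3 : (Real.pi * angle A x : ℝ) = Real.pi * x + ((linPart A).arg +
      (Complex.log (distortion A x)).im) := by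
    rw [angle]
    field_simp
  have e4 : (‖linPart A‖ * ‖distortion A x‖ : ℝ) *
      Complex.exp ((Real.pi * angle A x : ℝ) * Complex.I) =
      Complex.exp ((Real.pi * x : ℝ) * Complex.I) * (linPart A * distortion A x) := by
    rw [e3]
    conv_rhs => rw [e1, e2]
    rw [Complex.ofReal_add, Complex.ofReal_add, add_mul, add_mul, Complex.exp_add, Complex.exp_add]
    push_cast
    ring
  have e5 : linPart A * distortion A x = linPart A +
      antiPart A * (Complex.exp (-(Real.pi * x : ℝ) * Complex.I) *
        Complex.exp (-(Real.pi * x : ℝ) * Complex.I)) := by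
    rw [distortion, ← Complex.exp_add, mul_add, mul_one, ← mul_assoc,
      mul_div_cancel₀ _ (linPart_ne_zero A)]
    congr 3
    push_cast; ring
  have e6 : Complex.exp ((Real.pi * x : ℝ) * Complex.I) *
      Complex.exp (-(Real.pi * x : ℝ) * Complex.I) = 1 := by
    rw [← Complex.exp_add]; simp
  rw [e4, e5, mul_add, mul_left_comm, ← mul_assoc (Complex.exp _) (Complex.exp _), e6, one_mul,
    ← Complex.ofReal_neg, Complex.exp_mul_I, Complex.exp_mul_I, ← Complex.ofReal_cos,
    ← Complex.ofReal_sin, ← Complex.ofReal_cos, ← Complex.ofReal_sin, Real.cos_neg, Real.sin_neg]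
  generalize Real.cos (Real.pi * x) = u
  generalize Real.sin (Real.pi * x) = v
  apply Complex.ext <;> simp [linPart, antiPart] <;> ring

theorem smul_projPoint (x : ℝ) : A • projPoint x = projPoint (angle A x) := by
  have h := image_eq A x
  rw [Complex.exp_mul_I, ← Complex.ofReal_cos, ← Complex.ofReal_sin] at h
  have h0 := congrArg Complex.re h
  have h1 := congrArg Complex.im h
  simp only [Complex.mul_re, Complex.mul_im, Complex.add_re, Complex.add_im, Complex.ofReal_re,
    Complex.ofReal_im, Complex.I_re, Complex.I_im] at h0 h1
  rw [projPoint, projPoint, Projectivization.smul_mk, mk_eq_mk_iff_cross]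
  have m0 : (A • ![Real.cos (Real.pi * x), Real.sin (Real.pi * x)]) 0 =
      A 0 0 * Real.cos (Real.pi * x) + A 0 1 * Real.sin (Real.pi * x) := by
    simp [Matrix.SpecialLinearGroup.smul_def, Matrix.mulVec, dotProduct, Fin.sum_univ_two]
  have m1 : (A • ![Real.cos (Real.pi * x), Real.sin (Real.pi * x)]) 1 =
      A 1 0 * Real.cos (Real.pi * x) + A 1 1 * Real.sin (Real.pi * x) := by
    simp [Matrix.SpecialLinearGroup.smul_def, Matrix.mulVec, dotProduct, Fin.sum_univ_two]
  rw [m0, m1, h0, h1]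
  simp only [Matrix.cons_val_zero, Matrix.cons_val_one]
  ring

theorem coe_angle_angle (B : Matrix.SpecialLinearGroup (Fin 2) ℝ) (x : ℝ) :
    ((angle A (angle B x) : ℝ) : S1) = ((angle (A * B) x : ℝ) : S1) := by
  rw [← projPoint_eq_iff, ← smul_projPoint, ← smul_projPoint, ← smul_projPoint, mul_smul]

theorem exists_angle_inv : ∃ n : ℤ, ∀ x, angle A⁻¹ (angle A x) = x + n := by
  refine exists_int_of_coe_eq
    ((contDiff_angle A⁻¹).continuous.comp (contDiff_angle A).continuous) continuous_id fun x => ?_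
  rw [coe_angle_angle, ← projPoint_eq_iff, ← smul_projPoint, inv_mul_cancel, one_smul]

/-- Being inverted up to an integer by the angle map of A⁻¹, the map is injective, hence strictly
monotone. The relation under x ↦ x + 1 excludes the decreasing case. -/
theorem strictMono_angle : StrictMono (angle A) := by
  obtain ⟨n, hn⟩ := exists_angle_inv A
  have hinj : Function.Injective (angle A) := fun x y h => by
    have h1 := hn x
    rw [h, hn y] at h1
    linarith
  rcases (contDiff_angle A).continuous.strictMono_of_inj hinj with h | h
  · exact h
  · have h1 := h (zero_lt_one : (0 : ℝ) < 1)
    have h2 := angle_add_one A 0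
    rw [zero_add] at h2
    linarith

/-- The lift of the projective action of a matrix, as a degree one map. -/
noncomputable def angleLift : CircleDeg1Lift :=
  ⟨⟨angle A, (strictMono_angle A).monotone⟩, angle_add_one A⟩

theorem angleLift_apply (x : ℝ) : angleLift A x = angle A x := rfl

theorem exists_unit : ∃ F : CircleDeg1Liftˣ, (∀ x, F x = angle A x) ∧
    ∃ n : ℤ, ∀ x, (F⁻¹ : CircleDeg1Liftˣ) x = angle A⁻¹ x - n := by
  obtain ⟨n, hn⟩ := exists_angle_inv A
  obtain ⟨m, hm⟩ := exists_angle_inv A⁻¹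
  rw [inv_inv] at hm
  let G : CircleDeg1Lift := CircleDeg1Lift.translate (Multiplicative.ofAdd (-n : ℝ)) * angleLift A⁻¹
  have hG : ∀ x, G x = angle A⁻¹ x - n := fun x => by
    rw [CircleDeg1Lift.mul_apply, CircleDeg1Lift.translate_apply, angleLift_apply]; ring
  have hGF : ∀ x, G (angleLift A x) = x := fun x => by
    rw [hG, angleLift_apply, hn]; ring
  refine ⟨⟨angleLift A, G, CircleDeg1Lift.ext fun y => ?_, CircleDeg1Lift.ext hGF⟩,
    fun x => rfl, n, hG⟩
  obtain ⟨x, hx⟩ : ∃ x, angleLift A x = y := ⟨angle A⁻¹ (y - m), by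
    rw [angleLift_apply, hm]; ring⟩
  change angleLift A (G y) = y
  rw [← hx, hGF]

end ProjLift

theorem exists_isProjectiveMap (A : Matrix.SpecialLinearGroup (Fin 2) ℝ) :
    ∃ f : DiffPlus, IsProjectiveMap A f := by
  obtain ⟨F, hF, n, hn⟩ := ProjLift.exists_unit A
  have h1 : (F : ℝ → ℝ) = ProjLift.angle A := funext hF
  have h2 : ((F⁻¹ : CircleDeg1Liftˣ) : ℝ → ℝ) = fun x => ProjLift.angle A⁻¹ x - n := funext hn
  refine ⟨diffOfLift F (h1 ▸ ProjLift.contDiff_angle A)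
    (h2 ▸ (ProjLift.contDiff_angle A⁻¹).sub contDiff_const), fun x y h => ?_⟩
  rw [diffOfLift_smul, hF, ← projPoint_eq_iff] at h
  rw [ProjLift.smul_projPoint, h]

/-- The projective action as a homomorphism to the group of circle diffeomorphisms. -/
noncomputable def projDiff : Matrix.SpecialLinearGroup (Fin 2) ℝ →* DiffPlus where
  toFun A := (exists_isProjectiveMap A).choose
  map_one' := (exists_isProjectiveMap 1).choose_spec.unique IsProjectiveMap.one
  map_mul' A B := (exists_isProjectiveMap (A * B)).choose_spec.unique
    ((exists_isProjectiveMap A).choose_spec.mul (exists_isProjectiveMap B).choose_spec)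

theorem isProjectiveMap_projDiff (A : Matrix.SpecialLinearGroup (Fin 2) ℝ) :
    IsProjectiveMap A (projDiff A) := (exists_isProjectiveMap A).choose_spec

theorem isProjectiveMap_iff {A : Matrix.SpecialLinearGroup (Fin 2) ℝ} {f : DiffPlus} :
    IsProjectiveMap A f ↔ projDiff A = f :=
  ⟨(isProjectiveMap_projDiff A).unique, fun h => h ▸ isProjectiveMap_projDiff A⟩

theorem isFuchsian_map (Λ : Subgroup (Matrix.SpecialLinearGroup (Fin 2) ℝ)) [DiscreteTopology Λ] :
    IsFuchsian (Λ.map projDiff) :=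
  ⟨Λ, inferInstance, fun f => by simp only [Subgroup.mem_map, isProjectiveMap_iff]⟩

end CircleDiff

namespace CircleDiff

/-! ### Recognition of Cantor sets in the line. -/

section CantorRecognition

open Set Filter

/-- `[a, b]` cuts a nondegenerate relatively clopen piece out of `K`, with endpoints in `K`. -/
structure IsPiece (K : Set ℝ) (a b : ℝ) : Prop where
  left_mem : a ∈ K
  right_mem : b ∈ K
  left_acc : ∀ ε > 0, ∃ y ∈ K, a < y ∧ y < a + ε
  right_acc : ∀ ε > 0, ∃ y ∈ K, b - ε < y ∧ y < b
  lt : a < b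

theorem acc_iff {K : Set ℝ} {x : ℝ} (h : AccPt x (𝓟 K)) :
    ∀ ε > 0, ∃ y ∈ K, y ≠ x ∧ |y - x| < ε := fun ε hε => by
  obtain ⟨y, hy, hne⟩ := accPt_iff_nhds.1 h (Metric.ball x ε) (Metric.ball_mem_nhds x hε)
  exact ⟨y, hy.2, hne, by simpa [Real.dist_eq] using hy.1⟩

/-- Empty interior provides a point p outside K in the middle third, whence the factor 2/3. The cut
points are the last point of K before p and the first one after it. Perfectness makes K accumulate
at them, necessarily from the side away from p, so both halves are again pieces. -/
theorem IsPiece.split {K : Set ℝ} (hK : IsCompact K) (hacc : ∀ x ∈ K, AccPt x (𝓟 K))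
    (hint : interior K = ∅) {a b : ℝ} (h : IsPiece K a b) :
    ∃ a' b', IsPiece K a a' ∧ IsPiece K b' b ∧ a' < b' ∧ K ∩ Icc a b ⊆ Icc a a' ∪ Icc b' b ∧
      a' - a ≤ 2 / 3 * (b - a) ∧ b - b' ≤ 2 / 3 * (b - a) := by
  have hab := h.lt
  obtain ⟨p, hp, hpK⟩ : ∃ p ∈ Ioo (a + (b - a) / 3) (b - (b - a) / 3), p ∉ K := by
    by_contra! hcon
    have h1 : Ioo (a + (b - a) / 3) (b - (b - a) / 3) ⊆ interior K :=
      interior_maximal hcon isOpen_Ioo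
    rw [hint] at h1
    have hm : (a + b) / 2 ∈ Ioo (a + (b - a) / 3) (b - (b - a) / 3) :=
      ⟨by linarith, by linarith⟩
    exact h1 hm
  have hap : a < p := by linarith [hp.1]
  have hpb : p < b := by linarith [hp.2]
  obtain ⟨a', ha'⟩ := (hK.inter_right (isClosed_Icc (a := a) (b := p))).exists_isGreatest
    ⟨a, h.left_mem, le_rfl, hap.le⟩
  obtain ⟨b', hb'⟩ := (hK.inter_right (isClosed_Icc (a := p) (b := b))).exists_isLeast
    ⟨b, h.right_mem, hpb.le, le_rfl⟩
  have ha'p : a' < p := lt_of_le_of_ne ha'.1.2.2 fun e => hpK (e ▸ ha'.1.1)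
  have hb'p : p < b' := lt_of_le_of_ne hb'.1.2.1 fun e => hpK (e ▸ hb'.1.1)
  have haa' : a < a' := by
    obtain ⟨y, hy, h1, h2⟩ := h.left_acc (p - a) (by linarith)
    exact h1.trans_le (ha'.2 ⟨hy, h1.le, by linarith⟩)
  have hbb' : b' < b := by
    obtain ⟨y, hy, h1, h2⟩ := h.right_acc (b - p) (by linarith)
    exact (hb'.2 ⟨hy, by linarith, h2.le⟩).trans_lt h2
  refine ⟨a', b', ⟨h.left_mem, ha'.1.1, h.left_acc, fun ε hε => ?_, haa'⟩,
    ⟨hb'.1.1, h.right_mem, fun ε hε => ?_, h.right_acc, hbb'⟩, ha'p.trans hb'p, ?_,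
    by linarith [hp.2], by linarith [hp.1]⟩
  · obtain ⟨y, hy, hne, hlt⟩ := acc_iff (hacc a' ha'.1.1) (min ε (min (p - a') (a' - a)))
      (lt_min hε (lt_min (by linarith) (by linarith)))
    obtain ⟨h1, h2⟩ := lt_min_iff.1 hlt
    obtain ⟨h2, h3⟩ := lt_min_iff.1 h2
    rw [abs_lt] at h1 h2 h3
    have : y ≤ a' := ha'.2 ⟨hy, by linarith, by linarith⟩
    exact ⟨y, hy, by linarith, lt_of_le_of_ne this hne⟩
  · obtain ⟨y, hy, hne, hlt⟩ := acc_iff (hacc b' hb'.1.1) (min ε (min (b' - p) (b - b')))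
      (lt_min hε (lt_min (by linarith) (by linarith)))
    obtain ⟨h1, h2⟩ := lt_min_iff.1 hlt
    obtain ⟨h2, h3⟩ := lt_min_iff.1 h2
    rw [abs_lt] at h1 h2 h3
    have : b' ≤ y := hb'.2 ⟨hy, by linarith, by linarith⟩
    exact ⟨y, hy, lt_of_le_of_ne this hne.symm, by linarith⟩
  · rintro y ⟨hy, h1, h2⟩
    rcases le_total y p with h3 | h3
    · exact Or.inl ⟨h1, ha'.2 ⟨hy, h1, h3⟩⟩
    · exact Or.inr ⟨hb'.2 ⟨hy, h3, h2⟩, h2⟩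

theorem exists_isPiece {K : Set ℝ} (hK : IsCompact K) (hne : K.Nonempty)
    (hacc : ∀ x ∈ K, AccPt x (𝓟 K)) : ∃ a b, IsPiece K a b ∧ K ⊆ Icc a b := by
  obtain ⟨a, ha⟩ := hK.exists_isLeast hne
  obtain ⟨b, hb⟩ := hK.exists_isGreatest hne
  have h1 : ∀ ε > 0, ∃ y ∈ K, a < y ∧ y < a + ε := fun ε hε => by
    obtain ⟨y, hy, hne, hlt⟩ := acc_iff (hacc a ha.1) ε hε
    exact ⟨y, hy, lt_of_le_of_ne (ha.2 hy) hne.symm, by linarith [(abs_lt.1 hlt).2]⟩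
  have h2 : ∀ ε > 0, ∃ y ∈ K, b - ε < y ∧ y < b := fun ε hε => by
    obtain ⟨y, hy, hne, hlt⟩ := acc_iff (hacc b hb.1) ε hε
    exact ⟨y, hy, by linarith [(abs_lt.1 hlt).1], lt_of_le_of_ne (hb.2 hy) hne⟩
  obtain ⟨y, hy, hay, _⟩ := h1 1 one_pos
  exact ⟨a, b, ⟨ha.1, hb.1, h1, h2, hay.trans_le (hb.2 hy)⟩, fun z hz => ⟨ha.2 hz, hb.2 hz⟩⟩

/-- A compact perfect subset of the line with empty interior is a Cantor set. -/
theorem nonempty_homeomorph_of_perfect {K : Set ℝ} (hK : IsCompact K) (hne : K.Nonempty)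
    (hacc : ∀ x ∈ K, AccPt x (𝓟 K)) (hint : interior K = ∅) : Nonempty (K ≃ₜ (ℕ → Bool)) := by
  obtain ⟨a₀, b₀, h₀, hK₀⟩ := exists_isPiece hK hne hacc
  let P := {q : ℝ × ℝ // IsPiece K q.1 q.2}
  choose a' b' hl hr hlt hcov hdl hdr using fun q : P => q.2.split hK hacc hint
  -- The newest letter stands at the head of the word, as in `PiNat.res`; `false` selects the left
  -- piece and `true` the right one.
  let Q : List Bool → P := List.rec ⟨(a₀, b₀), h₀⟩ fun d _ q =>
    bif d then ⟨(b' q, q.1.2), hr q⟩ else ⟨(q.1.1, a' q), hl q⟩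
  have Qt : ∀ l, Q (true :: l) = ⟨(b' (Q l), (Q l).1.2), hr (Q l)⟩ := fun _ => rfl
  have Qf : ∀ l, Q (false :: l) = ⟨((Q l).1.1, a' (Q l)), hl (Q l)⟩ := fun _ => rfl
  let A : List Bool → Set ℝ := fun l => K ∩ Icc (Q l).1.1 (Q l).1.2
  have hanti : CantorScheme.Antitone A := fun l d => by
    have h1 := (hl (Q l)).lt
    have h2 := (hr (Q l)).lt
    have h3 := hlt (Q l)
    cases d
    · refine inter_subset_inter_right K (Icc_subset_Icc le_rfl ?_)
      rw [Qf]; exact (h3.trans h2).le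
    · refine inter_subset_inter_right K (Icc_subset_Icc ?_ le_rfl)
      rw [Qt]; exact (h1.trans h3).le
  have hdisj : CantorScheme.Disjoint A := fun l => by
    have key : Disjoint (A (false :: l)) (A (true :: l)) := by
      rw [Set.disjoint_left]
      rintro y ⟨_, hy⟩ ⟨_, hy'⟩
      rw [Qf] at hy
      rw [Qt] at hy'
      exact absurd (hy'.1.trans hy.2) (not_le.2 (hlt (Q l)))
    intro d e hde
    cases d <;> cases e
    · exact absurd rfl hde
    · exact key
    · exact key.symm
    · exact absurd rfl hde
  have hclosed : ∀ l, IsClosed (A l) := fun l => hK.isClosed.inter isClosed_Icc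
  have hnon : ∀ l, (A l).Nonempty := fun l =>
    ⟨(Q l).1.1, (Q l).2.left_mem, le_rfl, (Q l).2.lt.le⟩
  have hlen : ∀ l, (Q l).1.2 - (Q l).1.1 ≤ (2 / 3) ^ l.length * (b₀ - a₀) := fun l => by
    induction l with
    | nil => simp [Q]
    | cons d l ih =>
      rw [List.length_cons, pow_succ', mul_assoc]
      have h1 := hdl (Q l)
      have h2 := hdr (Q l)
      cases d
      · rw [Qf]; dsimp only; linarith
      · rw [Qt]; dsimp only; linarith
  have hdiam : CantorScheme.VanishingDiam A := fun x => by
    have h1 : Tendsto (fun n : ℕ => ENNReal.ofReal ((2 / 3) ^ n * (b₀ - a₀))) atTop (nhds 0) := by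
      have := (tendsto_pow_atTop_nhds_zero_of_lt_one (r := (2 / 3 : ℝ)) (by norm_num)
        (by norm_num)).mul_const (b₀ - a₀)
      rw [zero_mul] at this
      simpa using ENNReal.tendsto_ofReal this
    refine tendsto_of_tendsto_of_tendsto_of_le_of_le tendsto_const_nhds h1 (fun _ => zero_le)
      fun n => ?_
    refine (Metric.ediam_mono inter_subset_right).trans ?_
    rw [Real.ediam_Icc]
    refine ENNReal.ofReal_le_ofReal ((hlen _).trans ?_)
    rw [PiNat.res_length]
  have hdom := (hanti.closureAntitone hclosed).map_of_vanishingDiam hdiam hnon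
  let φ : (ℕ → Bool) → ℝ := fun x => (CantorScheme.inducedMap A).2 ⟨x, hdom ▸ trivial⟩
  have hφ : ∀ x n, φ x ∈ A (PiNat.res x n) := fun x n => CantorScheme.map_mem ⟨x, _⟩ n
  have hφc : Continuous φ := hdiam.map_continuous.comp (by fun_prop)
  have hφi : Function.Injective φ := fun x y h =>
    congrArg Subtype.val (hdisj.map_injective h)
  have hφs : ∀ y ∈ K, ∃ x, φ x = y := fun y hy => by
    have hstep : ∀ l, y ∈ A l → ∃ d, y ∈ A (d :: l) := fun l hyl => by
      rcases hcov (Q l) hyl with h | h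
      · exact ⟨false, hy, h⟩
      · exact ⟨true, hy, h⟩
    choose! d hd using hstep
    -- The address of y is built by choosing at each stage a half that contains it. The point with
    -- that address shares all pieces with y, and their diameters tend to 0.
    let L : ℕ → List Bool := Nat.rec [] fun _ l => d l :: l
    have hL : ∀ n, y ∈ A (L n) := fun n => by
      induction n with
      | zero => exact ⟨hy, hK₀ hy⟩
      | succ n ih => exact hd _ ih
    let x : ℕ → Bool := fun n => d (L n)
    have hres : ∀ n, PiNat.res x n = L n := fun n => by
      induction n with
      | zero => rfl
      | succ n ih => rw [PiNat.res_succ, ih]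
    refine ⟨x, ?_⟩
    by_contra hxy
    obtain ⟨n, hn⟩ := hdiam.dist_lt (dist (φ x) y) (dist_pos.2 hxy) x
    exact lt_irrefl _ (hn _ (hφ x n) y (by rw [hres]; exact hL n))
  let ψ : (ℕ → Bool) → K := fun x => ⟨φ x, (hφ x 0).1⟩
  have hψ : Function.Bijective ψ := ⟨fun x y h => hφi (congrArg Subtype.val h), fun y => by
    obtain ⟨x, hx⟩ := hφs y y.2
    exact ⟨x, Subtype.ext hx⟩⟩
  exact ⟨(Continuous.homeoOfEquivCompactToT2 (f := Equiv.ofBijective ψ hψ)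
    (hφc.subtype_mk _)).symm⟩

end CantorRecognition

end CircleDiff

namespace CircleDiff

open Set Filter

/-! ### Minimal sets of groups acting on the circle. -/

theorem isOpenMap_coe_S1 : IsOpenMap (fun x : ℝ => (x : S1)) :=
  QuotientAddGroup.isOpenMap_coe

/-- A proper closed perfect subset of the circle with empty interior is a Cantor set. -/
theorem nonempty_homeomorph_cantorSet {C : Set S1} (hC : IsClosed C) (hne : C.Nonempty)
    (hacc : ∀ p ∈ C, AccPt p (𝓟 C)) (hint : interior C = ∅) : Nonempty (C ≃ₜ cantorSet) := by
  -- Cutting the circle at a point outside C identifies C with a compact set in an open unit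
  -- interval.
  obtain ⟨q, hq⟩ : ∃ q, q ∉ C := by
    by_contra! h
    rw [eq_univ_of_forall h, interior_univ] at hint
    exact empty_ne_univ hint.symm
  obtain ⟨z, rfl⟩ := exists_coe_eq q
  let K : Set ℝ := {x | (x : S1) ∈ C} ∩ Icc z (z + 1)
  have hz1 : ((z + 1 : ℝ) : S1) = (z : S1) := coe_eq_coe_iff.2 ⟨1, by simp⟩
  have hKo : ∀ x ∈ K, x ∈ Ioo z (z + 1) := fun x hx =>
    ⟨lt_of_le_of_ne hx.2.1 fun e => hq (e ▸ hx.1),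
      lt_of_le_of_ne hx.2.2 fun e => hq (by rw [← hz1, ← e]; exact hx.1)⟩
  have hK : IsCompact K := isCompact_Icc.inter_left (hC.preimage continuous_coe_S1)
  have hsurj : ∀ p ∈ C, ∃ x ∈ K, (x : S1) = p := fun p hp => by
    obtain ⟨y, rfl⟩ := exists_coe_eq p
    have h1 := Int.floor_le (y - z)
    have h2 := Int.lt_floor_add_one (y - z)
    have h3 : ((y - ⌊y - z⌋ : ℝ) : S1) = (y : S1) :=
      coe_eq_coe_iff.2 ⟨-⌊y - z⌋, by push_cast; ring⟩
    refine ⟨y - ⌊y - z⌋, ⟨?_, by linarith, by linarith⟩, h3⟩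
    change ((y - ⌊y - z⌋ : ℝ) : S1) ∈ C
    rwa [h3]
  have hinj : ∀ x ∈ K, ∀ y ∈ K, (x : S1) = (y : S1) → x = y := fun x hx y hy h => by
    obtain ⟨n, hn⟩ := coe_eq_coe_iff.1 h
    have h1 := hKo x hx
    have h2 := hKo y hy
    have h3 : (n : ℝ) < 1 := by linarith [h1.2, h2.1]
    have h4 : (-1 : ℝ) < n := by linarith [h1.1, h2.2]
    have h5 : n < 1 := by exact_mod_cast h3
    have h6 : -1 < n := by exact_mod_cast h4
    have : n = 0 := by omega
    rw [hn, this]; simp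
  have hKacc : ∀ x ∈ K, AccPt x (𝓟 K) := fun x hx => by
    rw [accPt_iff_nhds]
    intro U hU
    have hW : interior U ∩ Ioo z (z + 1) ∈ nhds x :=
      inter_mem (interior_mem_nhds.2 hU) (isOpen_Ioo.mem_nhds (hKo x hx))
    obtain ⟨p, ⟨⟨y, hy, rfl⟩, hpC⟩, hne⟩ :=
      accPt_iff_nhds.1 (hacc _ hx.1) _ (isOpenMap_coe_S1.image_mem_nhds hW)
    exact ⟨y, ⟨interior_subset hy.1, hpC, Ioo_subset_Icc_self hy.2⟩, fun e => hne (by rw [e])⟩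
  have hKint : interior K = ∅ := by
    by_contra h
    obtain ⟨x, hx⟩ := nonempty_iff_ne_empty.2 h
    have h1 : (fun x : ℝ => (x : S1)) '' interior K ⊆ interior C := by
      refine interior_maximal ?_ (isOpenMap_coe_S1 _ isOpen_interior)
      rintro _ ⟨y, hy, rfl⟩
      exact (interior_subset hy).1
    rw [hint] at h1
    exact h1 ⟨x, hx, rfl⟩
  obtain ⟨p, hp⟩ := hne
  obtain ⟨x, hx, _⟩ := hsurj p hp
  obtain ⟨e⟩ := nonempty_homeomorph_of_perfect hK ⟨x, hx⟩ hKacc hKint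
  have : CompactSpace K := isCompact_iff_compactSpace.1 hK
  let ψ : K → C := fun x => ⟨(x : ℝ), x.2.1⟩
  have hψ : Function.Bijective ψ :=
    ⟨fun x y h => Subtype.ext (hinj x x.2 y y.2 (congrArg Subtype.val h)), fun q => by
      obtain ⟨x, hx, h⟩ := hsurj q q.2
      exact ⟨⟨x, hx⟩, Subtype.ext h⟩⟩
  have hψc : Continuous ψ := (continuous_coe_S1.comp continuous_subtype_val).subtype_mk _
  exact ⟨((Continuous.homeoOfEquivCompactToT2 (f := Equiv.ofBijective ψ hψ) hψc).symm.trans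
    e).trans cantorSetHomeomorphNatToBool.symm⟩

section MinimalSets

variable {Γ : Subgroup DiffPlus}

/-- A nonempty closed invariant set. -/
structure IsClosedInvariant (Γ : Subgroup DiffPlus) (C : Set S1) : Prop where
  nonempty : C.Nonempty
  isClosed : IsClosed C
  invariant : ∀ γ ∈ Γ, ∀ x ∈ C, γ • x ∈ C

theorem IsClosedInvariant.exists_minimal {C₀ : Set S1} (h : IsClosedInvariant Γ C₀) :
    ∃ C ⊆ C₀, Minimal (IsClosedInvariant Γ) C := by
  refine zorn_superset_nonempty {C | IsClosedInvariant Γ C} (fun c hc hchain hne => ?_) C₀ h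
  have := hne.to_subtype
  refine ⟨⋂₀ c, ⟨?_, isClosed_sInter fun s hs => (hc hs).isClosed, fun γ hγ x hx s hs =>
    (hc hs).invariant γ hγ x (hx s hs)⟩, fun s hs => sInter_subset_of_mem hs⟩
  exact IsCompact.nonempty_sInter_of_directed_nonempty_isCompact_isClosed
    (fun s hs t ht => (hchain.total hs ht).elim (fun h => ⟨s, hs, Subset.rfl, h⟩)
      fun h => ⟨t, ht, h, Subset.rfl⟩) (fun s hs => (hc hs).nonempty)
    (fun s hs => (hc hs).isClosed.isCompact) fun s hs => (hc hs).isClosed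

theorem smul_mem_closure {S : Set S1} (hS : ∀ γ ∈ Γ, ∀ x ∈ S, γ • x ∈ S) :
    ∀ γ ∈ Γ, ∀ x ∈ closure S, γ • x ∈ closure S := fun γ hγ _ hx =>
  map_mem_closure (continuous_smul_S1 γ) hx fun y hy => hS γ hγ y hy

theorem smul_mem_orbit (p : S1) : ∀ γ ∈ Γ, ∀ x ∈ MulAction.orbit Γ p,
    γ • x ∈ MulAction.orbit Γ p := fun γ hγ _ hx =>
  MulAction.mem_orbit_of_mem_orbit (⟨γ, hγ⟩ : Γ) hx

theorem subset_closure_orbit_of_minimal {C : Set S1} (hC : Minimal (IsClosedInvariant Γ) C)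
    {p : S1} (hp : p ∈ C) : C ⊆ closure (MulAction.orbit Γ p) := by
  have h := hC.prop
  refine hC.le_of_le ⟨⟨p, subset_closure (MulAction.mem_orbit_self p)⟩, isClosed_closure,
    smul_mem_closure (smul_mem_orbit p)⟩ (closure_minimal ?_ h.isClosed)
  rintro _ ⟨γ, rfl⟩
  exact h.invariant γ γ.2 p hp

theorem smul_isOpenMap (γ : DiffPlus) {U : Set S1} (hU : IsOpen U) :
    IsOpen ((fun p : S1 => γ • p) '' U) :=
  (γ.1.1.isOpenMap) U hU

/-- If p were isolated in C, every orbit in C, being dense there, would pass through p. Then C would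
be a single orbit of isolated points, and compactness would make it finite. -/
theorem accPt_of_minimal {C : Set S1} (hC : Minimal (IsClosedInvariant Γ) C)
    (hfin : ¬ HasFiniteOrbit Γ) {p : S1} (hp : p ∈ C) : AccPt p (𝓟 C) := by
  by_contra hacc
  rw [accPt_iff_nhds] at hacc
  push Not at hacc
  obtain ⟨U, hU, hUC⟩ := hacc
  obtain ⟨W, hWU, hW, hpW⟩ := mem_nhds_iff.1 hU
  have hWC : ∀ y ∈ W, y ∈ C → y = p := fun y hy hyC => hUC y ⟨hWU hy, hyC⟩
  have horb : C ⊆ MulAction.orbit Γ p := fun y hy => by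
    obtain ⟨w, hw, γ, hγ⟩ := mem_closure_iff.1 (subset_closure_orbit_of_minimal hC hy hp) W hW hpW
    have : w = p := hWC w hw (hγ ▸ hC.prop.invariant γ γ.2 y hy)
    exact MulAction.mem_orbit_symm.1 ⟨γ, hγ.trans this⟩
  have hcov : C ⊆ ⋃ γ : Γ, (fun q : S1 => (γ : DiffPlus) • q) '' W := fun y hy => by
    obtain ⟨γ, hγ⟩ := horb hy
    exact mem_iUnion.2 ⟨γ, p, hpW, hγ⟩
  obtain ⟨t, ht⟩ := hC.prop.isClosed.isCompact.elim_finite_subcover _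
    (fun γ : Γ => smul_isOpenMap (γ : DiffPlus) hW) hcov
  have hCfin : C ⊆ (fun γ : Γ => (γ : DiffPlus) • p) '' (t : Set Γ) := fun y hy => by
    obtain ⟨γ, hγt, w, hw, hwy⟩ := by simpa only [mem_iUnion] using ht hy
    have hwC : w ∈ C := by
      have := hC.prop.invariant (γ : DiffPlus)⁻¹ (Γ.inv_mem γ.2) y hy
      rw [← hwy] at this
      simpa only [inv_smul_smul] using this
    refine ⟨γ, hγt, ?_⟩
    rw [← hwy, hWC w hw hwC]
  refine hfin ⟨p, (t.finite_toSet.image _).subset (Subset.trans ?_ hCfin)⟩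
  rintro _ ⟨γ, rfl⟩
  exact hC.prop.invariant γ γ.2 p hp

/-- The points of C outside its interior form a closed invariant set. By minimality it is C or
empty, and in the latter case C is clopen, hence the whole connected circle. -/
theorem interior_eq_empty_of_minimal {C : Set S1} (hC : Minimal (IsClosedInvariant Γ) C)
    (hne : C ≠ univ) : interior C = ∅ := by
  have hconn : PreconnectedSpace S1 := ⟨by
    rw [← (show Function.Surjective fun x : ℝ => (x : S1) from exists_coe_eq).range_eq]
    exact isPreconnected_range continuous_coe_S1⟩
  have hint : ∀ γ ∈ Γ, ∀ x ∈ C, γ • x ∈ interior C → x ∈ interior C := fun γ hγ x hx h => by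
    have h1 := smul_isOpenMap γ⁻¹ (isOpen_interior (s := C))
    refine interior_maximal ?_ h1 ⟨γ • x, h, inv_smul_smul γ x⟩
    rintro _ ⟨y, hy, rfl⟩
    exact hC.prop.invariant _ (Γ.inv_mem hγ) y (interior_subset hy)
  by_cases hfr : (C \ interior C).Nonempty
  · have h : IsClosedInvariant Γ (C \ interior C) := ⟨hfr,
      hC.prop.isClosed.sdiff isOpen_interior, fun γ hγ x hx =>
        ⟨hC.prop.invariant γ hγ x hx.1, fun h => hx.2 (hint γ hγ x hx.1 h)⟩⟩
    have h1 := hC.le_of_le h sdiff_subset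
    exact eq_empty_of_forall_notMem fun x hx => (h1 (interior_subset hx)).2 hx
  · rw [not_nonempty_iff_eq_empty, sdiff_eq_empty] at hfr
    have hopen : IsOpen C := interior_eq_iff_isOpen.1 (interior_subset.antisymm hfr)
    exact absurd ((isClopen_iff.1 ⟨hC.prop.isClosed, hopen⟩).resolve_left
      hC.prop.nonempty.ne_empty) hne

/-- A group without finite orbits which preserves a proper closed set has an exceptional minimal
set. -/
theorem exists_isExceptionalMinimalSet {C₀ : Set S1} (h : IsClosedInvariant Γ C₀)
    (hne : C₀ ≠ univ) (hfin : ¬ HasFiniteOrbit Γ) :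
    ∃ C ⊆ C₀, IsExceptionalMinimalSet Γ C := by
  obtain ⟨C, hCC₀, hC⟩ := h.exists_minimal
  have hCne : C ≠ univ := fun e => hne (eq_univ_of_univ_subset (e ▸ hCC₀))
  exact ⟨C, hCC₀, hC.prop.nonempty, hC.prop.isClosed, hC.prop.invariant,
    fun p hp => subset_closure_orbit_of_minimal hC hp,
    nonempty_homeomorph_cantorSet hC.prop.isClosed hC.prop.nonempty
      (fun p hp => accPt_of_minimal hC hfin hp) (interior_eq_empty_of_minimal hC hCne)⟩

end MinimalSets

end CircleDiff

namespace CircleDiff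

open Set Filter

/-! ### A torsion-free Fuchsian group with an exceptional minimal set. -/

/-- The upper unipotent matrix. -/
def upper {R : Type*} [CommRing R] (k : R) : Matrix.SpecialLinearGroup (Fin 2) R :=
  ⟨!![1, k; 0, 1], by simp [Matrix.det_fin_two]⟩

/-- The lower unipotent matrix. -/
def lower {R : Type*} [CommRing R] (k : R) : Matrix.SpecialLinearGroup (Fin 2) R :=
  ⟨!![1, 0; k, 1], by simp [Matrix.det_fin_two]⟩

theorem upper_add (a b : ℝ) : upper (a + b) = upper a * upper b := by
  refine Subtype.ext ?_
  rw [Matrix.SpecialLinearGroup.coe_mul]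
  simp [upper, add_comm]

theorem lower_add (a b : ℝ) : lower (a + b) = lower a * lower b := by
  refine Subtype.ext ?_
  rw [Matrix.SpecialLinearGroup.coe_mul]
  simp [lower]

theorem upper_zero : upper (0 : ℝ) = 1 := by
  ext i j
  fin_cases i <;> fin_cases j <;> simp [upper]

theorem lower_zero : lower (0 : ℝ) = 1 := by
  ext i j
  fin_cases i <;> fin_cases j <;> simp [lower]

theorem upper_pow (a : ℝ) (n : ℕ) : upper a ^ n = upper (n * a) := by
  induction n with
  | zero => simp [upper_zero]
  | succ n ih => rw [pow_succ, ih, ← upper_add]; congr 1; push_cast; ring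

theorem lower_pow (a : ℝ) (n : ℕ) : lower a ^ n = lower (n * a) := by
  induction n with
  | zero => simp [lower_zero]
  | succ n ih => rw [pow_succ, ih, ← lower_add]; congr 1; push_cast; ring

theorem projDiff_smul_iff {A : Matrix.SpecialLinearGroup (Fin 2) ℝ} {x y : ℝ} :
    projDiff A • (x : S1) = (y : S1) ↔
      (A 0 0 * Real.cos (Real.pi * x) + A 0 1 * Real.sin (Real.pi * x)) * Real.sin (Real.pi * y) =
      (A 1 0 * Real.cos (Real.pi * x) + A 1 1 * Real.sin (Real.pi * x)) *
        Real.cos (Real.pi * y) := by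
  have h1 : projDiff A • (x : S1) = (y : S1) ↔ A • projPoint x = projPoint y := by
    refine ⟨isProjectiveMap_projDiff A x y, fun h => ?_⟩
    obtain ⟨z, hz⟩ := exists_coe_eq (projDiff A • (x : S1))
    rw [← hz, ← projPoint_eq_iff, ← isProjectiveMap_projDiff A x z hz.symm, h]
  rw [h1, projPoint, projPoint, Projectivization.smul_mk, mk_eq_mk_iff_cross]
  simp [Matrix.SpecialLinearGroup.smul_def, Matrix.mulVec, dotProduct, Fin.sum_univ_two]

theorem upper_smul_iff {k x y : ℝ} : projDiff (upper k) • (x : S1) = (y : S1) ↔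
    (Real.cos (Real.pi * x) + k * Real.sin (Real.pi * x)) * Real.sin (Real.pi * y) =
      Real.sin (Real.pi * x) * Real.cos (Real.pi * y) := by
  rw [projDiff_smul_iff]
  simp [upper]

theorem lower_smul_iff {k x y : ℝ} : projDiff (lower k) • (x : S1) = (y : S1) ↔
    Real.cos (Real.pi * x) * Real.sin (Real.pi * y) =
      (k * Real.cos (Real.pi * x) + Real.sin (Real.pi * x)) * Real.cos (Real.pi * y) := by
  rw [projDiff_smul_iff]
  simp [lower]

/-- A thin subgroup of the principal congruence subgroup of level three. -/
def thinGroup : Subgroup (Matrix.SpecialLinearGroup (Fin 2) ℤ) :=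
  Subgroup.closure {upper 3, lower 3}

/-- The group of circle diffeomorphisms generated by two parabolic projective maps. -/
noncomputable def schottkyGroup : Subgroup DiffPlus :=
  (thinGroup.map (Matrix.SpecialLinearGroup.map (Int.castRingHom ℝ))).map projDiff

theorem schottkyGroup_eq_closure :
    schottkyGroup = Subgroup.closure {projDiff (upper 3), projDiff (lower 3)} := by
  have h1 : Matrix.SpecialLinearGroup.map (Int.castRingHom ℝ) (upper 3) = upper 3 := by
    refine Subtype.ext ?_
    rw [Matrix.SpecialLinearGroup.map_apply_coe]
    ext i j
    fin_cases i <;> fin_cases j <;> simp [upper]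
  have h2 : Matrix.SpecialLinearGroup.map (Int.castRingHom ℝ) (lower 3) = lower 3 := by
    refine Subtype.ext ?_
    rw [Matrix.SpecialLinearGroup.map_apply_coe]
    ext i j
    fin_cases i <;> fin_cases j <;> simp [lower]
  rw [schottkyGroup, thinGroup, MonoidHom.map_closure, MonoidHom.map_closure, image_pair,
    image_pair, h1, h2]

theorem schottkyGroup_fg : schottkyGroup.FG :=
  (Subgroup.fg_iff _).2 ⟨_, schottkyGroup_eq_closure.symm, toFinite _⟩

theorem isFuchsian_schottkyGroup : IsFuchsian schottkyGroup := by
  have : DiscreteTopology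
      (thinGroup.map (Matrix.SpecialLinearGroup.map (Int.castRingHom ℝ))) :=
    DiscreteTopology.of_subset
      (s := ((Matrix.SpecialLinearGroup.map (n := Fin 2) (Int.castRingHom ℝ)).range : Set _))
      Matrix.SpecialLinearGroup.discreteSpecialLinearGroupIntRangeSL
      (by rintro _ ⟨B, _, h⟩; exact ⟨B, h⟩)
  exact isFuchsian_map _

/-- A matrix of determinant 1 congruent to the identity modulo 3 has trace congruent to 2 modulo 9,
so the trace cannot be -1, 0 or 1. This excludes elliptic elements and leads to torsion-freeness. -/
theorem two_le_abs_trace {B : Matrix.SpecialLinearGroup (Fin 2) ℤ} (hB : B ∈ thinGroup) :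
    2 ≤ |B 0 0 + B 1 1| := by
  have hle : thinGroup ≤ CongruenceSubgroup.Gamma 3 := by
    rw [thinGroup, Subgroup.closure_le]
    rintro _ (rfl | rfl) <;>
      · rw [SetLike.mem_coe, CongruenceSubgroup.Gamma_mem]
        simp [upper, lower]
        rfl
  obtain ⟨h1, h2, h3, h4⟩ := CongruenceSubgroup.Gamma_mem.1 (hle hB)
  have hdet : B 0 0 * B 1 1 - B 0 1 * B 1 0 = 1 := by
    have := B.2
    rwa [Matrix.det_fin_two] at this
  obtain ⟨x, hx⟩ : (3 : ℤ) ∣ B 0 0 - 1 := (ZMod.intCast_zmod_eq_zero_iff_dvd _ 3).1 (by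
    push_cast; rw [h1, sub_self])
  obtain ⟨y, hy⟩ : (3 : ℤ) ∣ B 1 1 - 1 := (ZMod.intCast_zmod_eq_zero_iff_dvd _ 3).1 (by
    push_cast; rw [h4, sub_self])
  obtain ⟨z, hz⟩ : (3 : ℤ) ∣ B 0 1 := (ZMod.intCast_zmod_eq_zero_iff_dvd _ 3).1 h2
  obtain ⟨w, hw⟩ : (3 : ℤ) ∣ B 1 0 := (ZMod.intCast_zmod_eq_zero_iff_dvd _ 3).1 h3
  have e1 : B 0 0 = 1 + 3 * x := by linarith
  have e2 : B 1 1 = 1 + 3 * y := by linarith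
  rw [e1, e2, hz, hw] at hdet
  have e3 : B 0 0 + B 1 1 = 2 - 9 * (x * y - z * w) := by rw [e1, e2]; linarith
  rw [e3]
  rcases lt_trichotomy (x * y - z * w) 0 with h | h | h
  · exact le_abs.2 (Or.inl (by omega))
  · rw [h]; norm_num
  · exact le_abs.2 (Or.inr (by omega))

theorem schottkyGroup_fixed {γ : DiffPlus} (hγ : γ ∈ schottkyGroup) : ∃ p : S1, γ • p = p := by
  obtain ⟨_, ⟨B, hB, rfl⟩, rfl⟩ := hγ
  have h : (2 : ℝ) ≤ |((B 0 0 : ℤ) : ℝ) + ((B 1 1 : ℤ) : ℝ)| := by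
    exact_mod_cast two_le_abs_trace hB
  obtain ⟨v, hv, c, hc⟩ := exists_eigenvector_of_two_le_abs_trace
    (Matrix.SpecialLinearGroup.map (Int.castRingHom ℝ) B) h
  exact (isProjectiveMap_projDiff _).smul_eq_of_eigenvector hv hc

theorem schottkyGroup_torsionFree : ∀ γ ∈ schottkyGroup, IsOfFinOrder γ → γ = 1 :=
  fun _ hγ hfin => by
    obtain ⟨p, hp⟩ := schottkyGroup_fixed hγ
    exact eq_one_of_isOfFinOrder_of_fixed hp hfin

theorem exists_pow_smul_eq_of_finite_orbit {Γ : Subgroup DiffPlus} {p : S1}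
    (h : (MulAction.orbit Γ p).Finite) {γ : DiffPlus} (hγ : γ ∈ Γ) :
    ∃ n : ℕ, 0 < n ∧ γ ^ n • p = p := by
  have := h.to_subtype
  obtain ⟨i, j, hij, he⟩ := Finite.exists_ne_map_eq_of_infinite
    fun n : ℕ => (⟨γ ^ n • p, ⟨⟨γ ^ n, Γ.pow_mem hγ n⟩, rfl⟩⟩ : MulAction.orbit Γ p)
  have he' : γ ^ i • p = γ ^ j • p := congrArg Subtype.val he
  wlog hlt : i < j generalizing i j
  · exact this j i hij.symm he.symm he'.symm (lt_of_le_of_ne (not_lt.1 hlt) hij.symm)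
  refine ⟨j - i, Nat.sub_pos_of_lt hlt, ?_⟩
  have h1 : γ ^ i • p = γ ^ i • γ ^ (j - i) • p := by
    rw [← mul_smul, ← pow_add, Nat.add_sub_cancel' hlt.le, he']
  exact (smul_left_cancel _ h1).symm

/-- A point with finite orbit is fixed by positive powers of both generators. An upper power fixes
only the points with sin πx = 0, a lower one only those with cos πx = 0. -/
theorem schottkyGroup_not_hasFiniteOrbit : ¬ HasFiniteOrbit schottkyGroup := by
  rintro ⟨p, hp⟩
  obtain ⟨x, rfl⟩ := exists_coe_eq p
  have hU : projDiff (upper 3) ∈ schottkyGroup := by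
    rw [schottkyGroup_eq_closure]; exact Subgroup.subset_closure (Or.inl rfl)
  have hL : projDiff (lower 3) ∈ schottkyGroup := by
    rw [schottkyGroup_eq_closure]; exact Subgroup.subset_closure (Or.inr rfl)
  obtain ⟨n, hn, h1⟩ := exists_pow_smul_eq_of_finite_orbit hp hU
  obtain ⟨m, hm, h2⟩ := exists_pow_smul_eq_of_finite_orbit hp hL
  rw [← map_pow, upper_pow, upper_smul_iff] at h1
  rw [← map_pow, lower_pow, lower_smul_iff] at h2
  have hn' : (n : ℝ) * 3 ≠ 0 := by positivity
  have hm' : (m : ℝ) * 3 ≠ 0 := by positivity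
  have h3 : n * 3 * Real.sin (Real.pi * x) ^ 2 = 0 := by linarith
  have h4 : m * 3 * Real.cos (Real.pi * x) ^ 2 = 0 := by linarith
  have h5 := (mul_eq_zero.1 h3).resolve_left hn'
  have h6 := (mul_eq_zero.1 h4).resolve_left hm'
  have := Real.sin_sq_add_cos_sq (Real.pi * x)
  rw [h5, h6] at this
  norm_num at this

/-- The function `cos (2 π x)` on the circle. -/
noncomputable def circleCos : S1 → ℝ :=
  Function.Periodic.lift (f := fun x : ℝ => Real.cos (2 * Real.pi * x)) (c := 1) fun x => by
    dsimp only
    rw [mul_add, mul_one, Real.cos_add_two_pi]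

theorem circleCos_coe (x : ℝ) : circleCos (x : S1) = Real.cos (2 * Real.pi * x) :=
  Function.Periodic.lift_coe _ x

theorem continuous_circleCos : Continuous circleCos :=
  continuous_of_coe (by simp only [circleCos_coe]; fun_prop)

theorem circleCos_coe_eq (x : ℝ) : circleCos (x : S1) = 2 * Real.cos (Real.pi * x) ^ 2 - 1 := by
  rw [circleCos_coe, ← Real.cos_two_mul, mul_assoc]

/-- From |c| ≤ |s|/2 and |k| ≥ 3 follows |c + ks| ≥ 3|s| - |s|/2 ≥ 2|s|. -/
theorem unipotent_estimate {c s k : ℝ} (hk : 3 ≤ |k|) (h : 4 * c ^ 2 ≤ s ^ 2) :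
    4 * s ^ 2 ≤ (c + k * s) ^ 2 := by
  have h1 : |2 * c| ≤ |s| := sq_le_sq.1 (by linarith)
  have h2 : |2 * s| ≤ |c + k * s| := by
    have h3 : |k * s| ≤ |c + k * s| + |c| := by
      have := abs_sub (c + k * s) c
      rwa [add_sub_cancel_left] at this
    have h4 : 3 * |s| ≤ |k * s| := by
      rw [abs_mul]; exact mul_le_mul_of_nonneg_right hk (abs_nonneg s)
    rw [abs_mul, abs_two] at h1 ⊢
    have := abs_nonneg s
    linarith
  have := sq_le_sq.2 h2
  linarith

theorem pingpong_estimate {c s u v k : ℝ} (hk : 3 ≤ |k|) (h1 : c ^ 2 + s ^ 2 = 1)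
    (h : 4 * c ^ 2 ≤ s ^ 2) (he : (c + k * s) * v = s * u) : 4 * v ^ 2 ≤ u ^ 2 := by
  have h2 := unipotent_estimate hk h
  have h3 : 0 < s ^ 2 := by linarith [sq_nonneg c]
  have h4 : (c + k * s) ^ 2 * v ^ 2 = s ^ 2 * u ^ 2 := by rw [← mul_pow, ← mul_pow, he]
  have h5 := mul_le_mul_of_nonneg_right h2 (sq_nonneg v)
  refine le_of_mul_le_mul_left ?_ h3
  linarith

theorem three_le_abs {k : ℤ} (hk : k ≠ 0) : (3 : ℝ) ≤ |3 * (k : ℝ)| := by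
  have h : (1 : ℝ) ≤ |(k : ℝ)| := by exact_mod_cast Int.one_le_abs hk
  rw [abs_mul]
  norm_num
  exact h

/-- The ping-pong domains are cos² πx ≥ 4 sin² πx and its mirror image, which in terms of
`circleCos` read ≥ 3/5 and ≤ -3/5. -/
theorem upper_pingpong {k : ℤ} (hk : k ≠ 0) {p : S1} (hp : circleCos p ≤ -(3 / 5)) :
    3 / 5 ≤ circleCos (projDiff (upper (3 * (k : ℝ))) • p) := by
  obtain ⟨x, rfl⟩ := exists_coe_eq p
  obtain ⟨y, hy⟩ := exists_coe_eq (projDiff (upper (3 * (k : ℝ))) • (x : S1))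
  rw [← hy]
  rw [circleCos_coe_eq] at hp ⊢
  have h1 := Real.sin_sq_add_cos_sq (Real.pi * x)
  have h2 := Real.sin_sq_add_cos_sq (Real.pi * y)
  have := pingpong_estimate (three_le_abs hk) (by linarith) (by linarith)
    (upper_smul_iff.1 hy.symm)
  linarith

theorem lower_pingpong {k : ℤ} (hk : k ≠ 0) {p : S1} (hp : 3 / 5 ≤ circleCos p) :
    circleCos (projDiff (lower (3 * (k : ℝ))) • p) ≤ -(3 / 5) := by
  obtain ⟨x, rfl⟩ := exists_coe_eq p
  obtain ⟨y, hy⟩ := exists_coe_eq (projDiff (lower (3 * (k : ℝ))) • (x : S1))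
  rw [← hy]
  rw [circleCos_coe_eq] at hp ⊢
  have h1 := Real.sin_sq_add_cos_sq (Real.pi * x)
  have h2 := Real.sin_sq_add_cos_sq (Real.pi * y)
  have h3 := lower_smul_iff.1 hy.symm
  have := pingpong_estimate (c := Real.sin (Real.pi * x)) (s := Real.cos (Real.pi * x))
    (u := Real.sin (Real.pi * y)) (v := Real.cos (Real.pi * y)) (three_le_abs hk)
    (by linarith) (by linarith) (by linarith)
  linarith

/-- The orbit of the fixed point `0` of the upper unipotents under alternating words; the boolean
records whether the last letter is upper (or the word is empty). -/
inductive PingPong : Bool → S1 → Prop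
  | base : PingPong true ((0 : ℝ) : S1)
  | up {p : S1} {k : ℤ} (hk : k ≠ 0) (hp : PingPong false p) :
      PingPong true (projDiff (upper (3 * (k : ℝ))) • p)
  | down {p : S1} {k : ℤ} (hk : k ≠ 0) (hp : PingPong true p) :
      PingPong false (projDiff (lower (3 * (k : ℝ))) • p)

theorem PingPong.bound {b : Bool} {p : S1} (h : PingPong b p) :
    if b then 3 / 5 ≤ circleCos p else circleCos p ≤ -(3 / 5) := by
  induction h with
  | base => rw [if_pos rfl, circleCos_coe]; norm_num
  | up hk _ ih => exact upper_pingpong hk (by simpa using ih)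
  | down hk _ ih => exact lower_pingpong hk (by simpa using ih)

/-- The orbit of `0` under alternating words. -/
def pingPongSet : Set S1 := {p | ∃ b, PingPong b p}

theorem upper_smul_upper (j k : ℤ) (p : S1) :
    projDiff (upper (3 * (j : ℝ))) • projDiff (upper (3 * (k : ℝ))) • p =
      projDiff (upper (3 * ((j + k : ℤ) : ℝ))) • p := by
  rw [← mul_smul, ← map_mul, ← upper_add]
  push_cast
  rw [mul_add]

theorem lower_smul_lower (j k : ℤ) (p : S1) :
    projDiff (lower (3 * (j : ℝ))) • projDiff (lower (3 * (k : ℝ))) • p =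
      projDiff (lower (3 * ((j + k : ℤ) : ℝ))) • p := by
  rw [← mul_smul, ← map_mul, ← lower_add]
  push_cast
  rw [mul_add]

theorem upper_zero_smul (p : S1) : projDiff (upper (3 * ((0 : ℤ) : ℝ))) • p = p := by
  rw [Int.cast_zero, mul_zero, upper_zero, map_one, one_smul]

theorem lower_zero_smul (p : S1) : projDiff (lower (3 * ((0 : ℤ) : ℝ))) • p = p := by
  rw [Int.cast_zero, mul_zero, lower_zero, map_one, one_smul]

/-- An upper letter put before an alternating word lengthens it, merges with an upper first letter
or cancels it. The empty word absorbs it, since 0 is a fixed point. -/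
theorem upper_smul_mem_pingPongSet (k : ℤ) {p : S1} (hp : p ∈ pingPongSet) :
    projDiff (upper (3 * (k : ℝ))) • p ∈ pingPongSet := by
  obtain ⟨b, h⟩ := hp
  by_cases hk : k = 0
  · rw [hk, upper_zero_smul]; exact ⟨b, h⟩
  cases h with
  | base =>
    have : projDiff (upper (3 * (k : ℝ))) • ((0 : ℝ) : S1) = ((0 : ℝ) : S1) :=
      upper_smul_iff.2 (by simp)
    rw [this]; exact ⟨true, PingPong.base⟩
  | @up q j hj hq =>
    rw [upper_smul_upper]
    by_cases hkj : k + j = 0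
    · rw [hkj, upper_zero_smul]; exact ⟨false, hq⟩
    · exact ⟨true, PingPong.up hkj hq⟩
  | down hj hq => exact ⟨true, PingPong.up hk (PingPong.down hj hq)⟩

theorem lower_smul_mem_pingPongSet (k : ℤ) {p : S1} (hp : p ∈ pingPongSet) :
    projDiff (lower (3 * (k : ℝ))) • p ∈ pingPongSet := by
  obtain ⟨b, h⟩ := hp
  by_cases hk : k = 0
  · rw [hk, lower_zero_smul]; exact ⟨b, h⟩
  cases h with
  | base => exact ⟨false, PingPong.down hk PingPong.base⟩
  | up hj hq => exact ⟨false, PingPong.down hk (PingPong.up hj hq)⟩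
  | @down q j hj hq =>
    rw [lower_smul_lower]
    by_cases hkj : k + j = 0
    · rw [hkj, lower_zero_smul]; exact ⟨true, hq⟩
    · exact ⟨false, PingPong.down hkj hq⟩

/-- Stated as an equivalence because, unlike the implication, it passes to inverses in the closure
induction. -/
theorem smul_mem_pingPongSet {γ : DiffPlus} (hγ : γ ∈ schottkyGroup) (p : S1) :
    γ • p ∈ pingPongSet ↔ p ∈ pingPongSet := by
  have hone : (3 : ℝ) = 3 * ((1 : ℤ) : ℝ) := by norm_num
  rw [schottkyGroup_eq_closure] at hγ
  induction hγ using Subgroup.closure_induction generalizing p with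
  | mem γ h =>
    rcases h with rfl | rfl
    · rw [hone]
      refine ⟨fun h => ?_, upper_smul_mem_pingPongSet 1⟩
      have := upper_smul_mem_pingPongSet (-1) h
      rwa [upper_smul_upper, neg_add_cancel, upper_zero_smul] at this
    · rw [hone]
      refine ⟨fun h => ?_, lower_smul_mem_pingPongSet 1⟩
      have := lower_smul_mem_pingPongSet (-1) h
      rwa [lower_smul_lower, neg_add_cancel, lower_zero_smul] at this
  | one => rw [one_smul]
  | mul a b _ _ ha hb =>
    rw [mul_smul]
    exact (ha _).trans (hb _)
  | inv a _ ha =>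
    have := ha (a⁻¹ • p)
    rw [smul_inv_smul] at this
    exact this.symm

theorem isClosedInvariant_closure_pingPongSet :
    IsClosedInvariant schottkyGroup (closure pingPongSet) :=
  ⟨⟨((0 : ℝ) : S1), subset_closure ⟨true, PingPong.base⟩⟩, isClosed_closure,
    smul_mem_closure fun _ hγ p hp => (smul_mem_pingPongSet hγ p).2 hp⟩

theorem closure_pingPongSet_ne_univ : closure pingPongSet ≠ univ := fun h => by
  have hcl : IsClosed {p : S1 | 3 / 5 ≤ |circleCos p|} :=
    isClosed_le continuous_const continuous_circleCos.abs
  have hsub : closure pingPongSet ⊆ {p : S1 | 3 / 5 ≤ |circleCos p|} := by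
    refine closure_minimal ?_ hcl
    rintro p ⟨b, hb⟩
    have := hb.bound
    cases b
    · have h' : circleCos p ≤ -(3 / 5) := by simpa using this
      exact le_abs.2 (Or.inr (le_neg.1 h'))
    · exact le_abs.2 (Or.inl (by simpa using this))
  -- The cosine vanishes at 1/4, which therefore lies between the two ping-pong domains.
  have h1 : 3 / 5 ≤ |circleCos (((1 / 4 : ℝ)) : S1)| := hsub (h ▸ mem_univ _)
  rw [circleCos_coe, show 2 * Real.pi * (1 / 4) = Real.pi / 2 by ring, Real.cos_pi_div_two] at h1
  norm_num at h1

theorem exists_isExceptionalMinimalSet_schottkyGroup :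
    ∃ C : Set S1, C ≠ univ ∧ IsExceptionalMinimalSet schottkyGroup C := by
  obtain ⟨C, hC, h⟩ := exists_isExceptionalMinimalSet isClosedInvariant_closure_pingPongSet
    closure_pingPongSet_ne_univ schottkyGroup_not_hasFiniteOrbit
  exact ⟨C, fun e => closure_pingPongSet_ne_univ (eq_univ_of_univ_subset (e ▸ hC)), h⟩

end CircleDiff

namespace CircleDiff

open Set Filter

/-! ### The vector field in a gap, the group ℤ ⊕ ℤ, and existence of the data. -/

theorem locallyConnectedSpace_S1 : LocallyConnectedSpace S1 :=
  (QuotientAddGroup.isQuotientMap_mk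
    (N := AddSubgroup.zmultiples (1 : ℝ))).isCoinducing.locallyConnectedSpace

/-- A smooth bump on the circle around the point `x`. -/
noncomputable def circleBump (x κ : ℝ) (p : S1) : ℝ :=
  Real.smoothTransition (circleCos (p - (x : S1)) - κ)

theorem circleBump_coe (x κ y : ℝ) : circleBump x κ (y : S1) =
    Real.smoothTransition (Real.cos (2 * Real.pi * (y - x)) - κ) := by
  rw [circleBump, ← AddCircle.coe_sub, circleCos_coe]

theorem isSmoothVectorField_circleBump (x κ : ℝ) : IsSmoothVectorField (circleBump x κ) := by
  unfold IsSmoothVectorField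
  simp only [circleBump_coe]
  exact Real.smoothTransition.contDiff.comp
    ((Real.contDiff_cos.comp (contDiff_const.mul (contDiff_id.sub contDiff_const))).sub
      contDiff_const)

theorem circleCos_lt_one {p : S1} (hp : p ≠ 0) : circleCos p < 1 := by
  obtain ⟨y, rfl⟩ := exists_coe_eq p
  rw [circleCos_coe]
  refine lt_of_le_of_ne (Real.cos_le_one _) fun h => hp ?_
  obtain ⟨n, hn⟩ := (Real.cos_eq_one_iff _).1 h
  have h1 : y = 0 + (n : ℝ) := by
    have h2 : 2 * Real.pi * y = 2 * Real.pi * n := by rw [← hn]; ring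
    rw [zero_add]
    exact mul_left_cancel₀ (by positivity) h2
  exact coe_eq_coe_iff.2 ⟨n, h1⟩

/-- Every nonempty open subset of the circle supports a nontrivial smooth vector field. -/
theorem exists_smooth_vanishing {I : Set S1} (hI : IsOpen I) {p : S1} (hp : p ∈ I) :
    ∃ X : S1 → ℝ, IsSmoothVectorField X ∧ X ≠ 0 ∧ ∀ q ∉ I, X q = 0 := by
  obtain ⟨x, rfl⟩ := exists_coe_eq p
  -- The threshold κ is the maximum of the cosine centred at x over the compact complement of I. It
  -- is below 1 because x lies in I, so the bump is positive at x and vanishes off I.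
  obtain ⟨κ, hκ1, hκ⟩ : ∃ κ < 1, ∀ q ∉ I, circleCos (q - (x : S1)) ≤ κ := by
    rcases (Iᶜ).eq_empty_or_nonempty with h | h
    · exact ⟨0, one_pos, fun q hq => absurd (h ▸ hq : q ∈ (∅ : Set S1)) (notMem_empty q)⟩
    · obtain ⟨m, hm, hmax⟩ := hI.isClosed_compl.isCompact.exists_isMaxOn h
        (continuous_circleCos.comp (continuous_id.sub continuous_const)).continuousOn
      exact ⟨circleCos (m - (x : S1)),
        circleCos_lt_one (sub_ne_zero.2 fun e => hm (e ▸ hp)), fun q hq => hmax hq⟩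
  refine ⟨circleBump x κ, isSmoothVectorField_circleBump x κ, fun h => ?_, fun q hq =>
    Real.smoothTransition.zero_of_nonpos (sub_nonpos.2 (hκ q hq))⟩
  have h1 := congrFun h (x : S1)
  rw [circleBump_coe, sub_self, mul_zero, Real.cos_zero] at h1
  exact (Real.smoothTransition.pos_of_pos (sub_pos.2 hκ1)).ne' h1

/-- The homomorphism from `ℤ ⊕ ℤ` to the flow, with times `m + n √2`. -/
noncomputable def flowHom {V : ℝ → ℝ} (hV : SmoothPeriodic V) :
    Multiplicative (ℤ × ℤ) →* DiffPlus where
  toFun v := hV.flowDiff (v.toAdd.1 + v.toAdd.2 * Real.sqrt 2)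
  map_one' := by simp [hV.flowDiff_zero]
  map_mul' v w := by
    rw [← hV.flowDiff_add]
    congr 1
    simp only [toAdd_mul, Prod.fst_add, Prod.snd_add]
    push_cast
    ring

theorem flowHom_ofAdd {V : ℝ → ℝ} (hV : SmoothPeriodic V) (m n : ℤ) :
    flowHom hV (Multiplicative.ofAdd (m, n)) = hV.flowDiff (m + n * Real.sqrt 2) := rfl

/-- Only time 0 gives the identity, and m + n√2 = 0 forces m = n = 0 because √2 is irrational. -/
theorem flowHom_injective {V : ℝ → ℝ} (hV : SmoothPeriodic V) {z : ℝ} (hz : V z = 0) {x : ℝ}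
    (hx : V x ≠ 0) : Function.Injective (flowHom hV) := by
  rw [injective_iff_map_eq_one]
  intro v hv
  have h : (v.toAdd.1 : ℝ) + v.toAdd.2 * Real.sqrt 2 = 0 :=
    hV.eq_zero_of_flowDiff_eq_one hz hx hv
  have h2 : v.toAdd.2 = 0 := by
    by_contra hne
    refine irrational_sqrt_two ⟨-v.toAdd.1 / v.toAdd.2, ?_⟩
    have : (v.toAdd.2 : ℝ) ≠ 0 := by exact_mod_cast hne
    push_cast
    field_simp
    linarith
  rw [h2] at h
  have h1 : v.toAdd.1 = 0 := by simpa using h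
  exact congrArg Multiplicative.ofAdd (Prod.ext h1 h2 : v.toAdd = 0)

theorem dense_flowHom_times {V : ℝ → ℝ} (hV : SmoothPeriodic V) :
    Dense {t : ℝ | hV.flowDiff t ∈ (flowHom hV).range} := by
  have h := dense_addSubgroupClosure_pair_iff.2
    (show Irrational (Real.sqrt 2 / 1) by rw [div_one]; exact irrational_sqrt_two)
  refine h.mono fun t ht => ?_
  obtain ⟨n, m, rfl⟩ := AddSubgroup.mem_closure_pair.1 ht
  refine ⟨Multiplicative.ofAdd (m, n), ?_⟩
  rw [flowHom_ofAdd]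
  congr 1
  simp only [zsmul_eq_mul, mul_one]
  ring

theorem exists_isConstruction :
    ∃ (Γ₁ : Subgroup DiffPlus) (C I : Set S1) (X : S1 → ℝ) (Γ₂ : Subgroup DiffPlus),
      IsConstruction Γ₁ C I X Γ₂ := by
  obtain ⟨C, hne, hC⟩ := exists_isExceptionalMinimalSet_schottkyGroup
  obtain ⟨p, hp⟩ : Cᶜ.Nonempty := nonempty_compl.2 hne
  have := locallyConnectedSpace_S1
  have hI : IsOpen (connectedComponentIn Cᶜ p) := hC.isClosed.isOpen_compl.connectedComponentIn
  obtain ⟨X, hX, hX0, hXI⟩ := exists_smooth_vanishing hI (mem_connectedComponentIn hp)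
  obtain ⟨c, hc⟩ := hC.nonempty
  obtain ⟨z, rfl⟩ := exists_coe_eq c
  have hz : X (z : S1) = 0 := hXI _ fun h => connectedComponentIn_subset _ _ h hc
  obtain ⟨q, hq⟩ := Function.ne_iff.1 hX0
  obtain ⟨x, rfl⟩ := exists_coe_eq q
  refine ⟨schottkyGroup, C, _, X, (flowHom hX.smoothPeriodic).range, isFuchsian_schottkyGroup,
    schottkyGroup_fg, schottkyGroup_torsionFree, hC, ⟨p, hp, rfl⟩, hX, hX0, hXI,
    ⟨(MonoidHom.ofInjective (flowHom_injective hX.smoothPeriodic hz hq)).symm⟩, ?_, ?_⟩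
  · rintro _ ⟨v, rfl⟩
    exact ⟨_, (isFlowMap_iff hX).2 rfl⟩
  · exact (dense_flowHom_times hX.smoothPeriodic).mono fun t ht =>
      ⟨_, ht, (isFlowMap_iff hX).2 rfl⟩

end CircleDiff

theorem mainTheorem11 :
    -- the construction can be carried out
    (∃ (Γ₁ : Subgroup DiffPlus) (C I : Set S1) (X : S1 → ℝ) (Γ₂ : Subgroup DiffPlus),
      IsConstruction Γ₁ C I X Γ₂) ∧
    -- every group obtained from it has the listed properties
    (∀ (Γ₁ : Subgroup DiffPlus) (C I : Set S1) (X : S1 → ℝ) (Γ₂ : Subgroup DiffPlus),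
      IsConstruction Γ₁ C I X Γ₂ →
        (Γ₁ ⊔ Γ₂).FG ∧
        ¬ IsCrDiscrete ⊤ (Γ₁ ⊔ Γ₂) ∧
        ContainsZSquared (Γ₁ ⊔ Γ₂) ∧
        rotationImage (Γ₁ ⊔ Γ₂) = {0} ∧
        ¬ HasFiniteOrbit (Γ₁ ⊔ Γ₂)) ∧
    -- the equivalence for `C¹`-nondiscrete groups fails for `C^∞` diffeomorphisms
    (¬ ∀ Γ : Subgroup DiffPlus, ¬ IsCrDiscrete 1 Γ →
        ((rotationImage Γ).Finite ↔ HasFiniteOrbit Γ)) ∧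
    -- both assertions on groups without finite orbit fail for `C^∞` diffeomorphisms
    (¬ ∀ Γ : Subgroup DiffPlus, ¬ HasFiniteOrbit Γ → (rotationImage Γ).Finite →
        IsCrDiscrete 1 Γ) ∧
    (¬ ∀ Γ : Subgroup DiffPlus, ¬ HasFiniteOrbit Γ → (rotationImage Γ).Finite →
        ∀ Γ' : Subgroup DiffPlus, Γ' ≤ Γ →
          (Finite Γ' ∨ ContainsInfiniteCyclicFiniteIndex Γ' ∨ ContainsNonabelianFree Γ')) :=
  ⟨exists_isConstruction, main_of_exists exists_isConstruction⟩
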